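/- **Theorem.** All vector spaces are over $\mathbb{C}$. A superalgebra is a $\mathbb{Z}_2$-graded algebra $J=J_0\oplus J_1$ with $J_iJ_j\subseteq J_{i+j}$; write $|x|=i$ for $x\in J_i$. It is a *Jordan superalgebra* if $xy=(-1)^{|x||y|}yx$ and $$(wx)(yz)+(-1)^{|x||y|}(wy)(xz)+(-1)^{(|x|+|y|)|z|}(wz)(xy)-(-1)^{|w||x|}x(w(yz))-(-1)^{|y|(|w|+|x|)}y(w(xz))-(-1)^{|z|(|w|+|x|+|y|)}z(w(xy))=0$$ for all homogeneous $x,y,z,w$. It is *nilpotent* if $J^k=0$ for some $k\ge 1$, where $J^1=J$ and $J^{k+1}=J^kJ+J^{k-1}J^2+\cdots+JJ^k$, and it is of *type* $(m,n)$ if $\dim J_0=m$ and $\dim J_1=n$. Isomorphisms are algebra isomorphisms preserving the grading. Consider the following superalgebras with even basis $e_1,e_2,e_3$ and odd basis $f_1,f_2$. Only the nonzero products of basis vectors are listed, up to supercommutativity ($e_je_i=e_ie_j$, $f_je_i=e_if_j$, $f_2f_1=-f_1f_2$). - Even part $J_{3,1}$ (zero product): - $(3,2)_{1}$: all products zero -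 $(3,2)_{2}$: $f_1f_2=e_2$ - $(3,2)_{3}$: $e_1f_2=f_1$ - $(3,2)_{4}$: $e_1f_2=f_1,\ f_1f_2=e_2$ - Even part $J_{3,2}$ ($e_1^2=e_2$): - $(3,2)_{5}$: $e_1^2=e_2$ - $(3,2)_{6}$: $e_1^2=e_2,\ f_1f_2=e_1$ - $(3,2)_{7}$: $e_1^2=e_2,\ f_1f_2=e_2$ - $(3,2)_{8}$: $e_1^2=e_2,\ f_1f_2=e_3$ - $(3,2)_{9}$: $e_1^2=e_2,\ e_2f_2=f_1$ - $(3,2)_{10}$: $e_1^2=e_2,\ e_3f_2=f_1$ - $(3,2)_{11}$: $e_1^2=e_2,\ e_3f_2=f_1,\ f_1f_2=e_2$ - $(3,2)_{12}$: $e_1^2=e_2,\ e_1f_2=f_1$ - $(3,2)_{13}$: $e_1^2=e_2,\ e_1f_2=f_1,\ f_1f_2=e_2$ - $(3,2)_{14}$: $e_1^2=e_2,\ e_1f_2=f_1,\ f_1f_2=e_3$ - Even part $J_{3,3}$ ($e_1e_2=e_3$): - $(3,2)_{15}$: $e_1e_2=e_3$ - $(3,2)_{16}$: $e_1e_2=e_3,\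 f_1f_2=e_1$ - $(3,2)_{17}$: $e_1e_2=e_3,\ f_1f_2=e_3$ - $(3,2)_{18}$: $e_1e_2=e_3,\ f_1f_2=e_1+e_2$ - $(3,2)_{19}$: $e_1e_2=e_3,\ e_3f_2=f_1$ - $(3,2)_{20}$: $e_1e_2=e_3,\ e_1f_2=f_1$ - $(3,2)_{21}$: $e_1e_2=e_3,\ e_1f_2=f_1,\ f_1f_2=e_3$ - $(3,2)_{22}$: $e_1e_2=e_3,\ e_1f_2=e_2f_2=f_1$ - $(3,2)_{23}$: $e_1e_2=e_3,\ e_1f_2=e_2f_2=f_1,\ f_1f_2=e_3$ - Even part $J_{3,4}$ ($e_1^2=e_2,\ e_1e_2=e_3$): - $(3,2)_{24}$: $e_1^2=e_2,\ e_1e_2=e_3$ - $(3,2)_{25}$: $e_1^2=e_2,\ e_1e_2=e_3,\ f_1f_2=e_2$ - $(3,2)_{26}$: $e_1^2=e_2,\ e_1e_2=e_3,\ f_1f_2=e_3$ - $(3,2)_{27}$: $e_1^2=e_2,\ e_1e_2=e_3,\ e_2f_2=f_1$ - $(3,2)_{28}$: $e_1^2=e_2,\ e_1e_2=e_3,\ e_1f_2=f_1$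 - $(3,2)_{29}$: $e_1^2=e_2,\ e_1e_2=e_3,\ e_1f_2=f_1,\ f_1f_2=e_3$ Each of these 29 superalgebras is a nilpotent Jordan superalgebra of type $(3,2)$, they are pairwise non-isomorphic, the algebras $J_{3,1},\dots,J_{3,4}$ are pairwise non-isomorphic, and every nilpotent Jordan superalgebra of type $(3,2)$ is isomorphic to exactly one of the 29. -/

import Mathlib

namespace JordanSuper

/-- A complex superalgebra structure on the vector space `J`: a bilinear product together with a
`ZMod 2`-grading `J = J₀ ⊕ J₁` such that `Jᵢ Jⱼ ⊆ Jᵢ₊ⱼ`. -/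
structure Superalgebra (J : Type*) [AddCommGroup J] [Module ℂ J] where
  mul : J →ₗ[ℂ] J →ₗ[ℂ] J
  part : ZMod 2 → Submodule ℂ J
  isCompl : IsCompl (part 0) (part 1)
  mul_mem : ∀ (i j : ZMod 2) (x y : J), x ∈ part i → y ∈ part j → mul x y ∈ part (i + j)

/-- The sign `(-1) ^ i` of a parity `i`. -/
def sgn (i : ZMod 2) : ℂ := (-1) ^ i.val

namespace Superalgebra

variable {J : Type*} [AddCommGroup J] [Module ℂ J]

/-- Jordan superalgebras: supercommutativity and the Jordan superidentity, for all homogeneous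
elements `x, y, z, w` of parities `i, j, k, l`. -/
structure IsJordan (A : Superalgebra J) : Prop where
  supercomm : ∀ (i j : ZMod 2) (x y : J), x ∈ A.part i → y ∈ A.part j →
    A.mul x y = sgn (i * j) • A.mul y x
  superidentity : ∀ (i j k l : ZMod 2) (x y z w : J),
    x ∈ A.part i → y ∈ A.part j → z ∈ A.part k → w ∈ A.part l →
      A.mul (A.mul w x) (A.mul y z)
        + sgn (i * j) • A.mul (A.mul w y) (A.mul x z)
        + sgn ((i + j) * k) • A.mul (A.mul w z) (A.mul x y)
        - sgn (l * i) • A.mul x (A.mul w (A.mul y z))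
        - sgn (j * (l + i)) • A.mul y (A.mul w (A.mul x z))
        - sgn (k * (l + i + j)) • A.mul z (A.mul w (A.mul x y)) = 0

/-- The powers `J¹ = J` and `Jᵏ⁺¹ = Jᵏ J + Jᵏ⁻¹ J² + ⋯ + J Jᵏ`, where the product of two subspaces
is the span of the products of their elements. The value at `0` is a convention and is not used. -/
def power (A : Superalgebra J) : ℕ → Submodule ℂ J
  | 0 => ⊤
  | 1 => ⊤
  | k + 2 => ⨆ i : Fin (k + 1), Submodule.map₂ A.mul (A.power (k + 1 - i)) (A.power (i + 1))
  termination_by k => k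
  decreasing_by
    · omega
    · have := i.isLt
      omega

/-- `J` is nilpotent if `Jᵏ = 0` for some positive integer `k`. -/
def IsNilpotent (A : Superalgebra J) : Prop := ∃ k : ℕ, 0 < k ∧ A.power k = ⊥

/-- Type `(m, n)`: `dim J₀ = m` and `dim J₁ = n`. -/
def HasType (A : Superalgebra J) (m n : ℕ) : Prop :=
  Module.Finite ℂ J ∧ Module.finrank ℂ (A.part 0) = m ∧ Module.finrank ℂ (A.part 1) = n

/-- Isomorphism of superalgebras: a linear bijection that is multiplicative and preserves the
grading. -/
def Iso {J' : Type*} [AddCommGroup J'] [Module ℂ J'] (A : Superalgebra J) (B : Superalgebra J') :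
    Prop :=
  ∃ Φ : J ≃ₗ[ℂ] J', (∀ x y : J, Φ (A.mul x y) = B.mul (Φ x) (Φ y)) ∧
    ∀ i : ZMod 2, (A.part i).map (Φ : J →ₗ[ℂ] J') = B.part i

/-- The even part `J₀`, with the restricted product, is isomorphic to the algebra `(E, m)`. -/
def EvenPartIso {E : Type*} [AddCommGroup E] [Module ℂ E] (A : Superalgebra J)
    (m : E →ₗ[ℂ] E →ₗ[ℂ] E) : Prop :=
  ∃ T : A.part 0 ≃ₗ[ℂ] E, ∀ x y z : A.part 0, (z : J) = A.mul x y → T z = m (T x) (T y)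

end Superalgebra

/-- Names for the nilpotent Jordan algebras of dimension three. -/
inductive EvenType
  | J31
  | J32
  | J33
  | J34

/-- The commutative products on `ℂ³`, with basis `e₁, e₂, e₃`, whose nonzero products of basis
vectors are, up to commutativity,
* `J31`: none;
* `J32`: `e₁² = e₂`;
* `J33`: `e₁e₂ = e₃`;
* `J34`: `e₁² = e₂`, `e₁e₂ = e₃`. -/
def evenMul (r : EvenType) : (Fin 3 → ℂ) →ₗ[ℂ] (Fin 3 → ℂ) →ₗ[ℂ] (Fin 3 → ℂ) :=
  LinearMap.mk₂ ℂ
    (fun a b => match r with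
      | .J31 => ![0, 0, 0]
      | .J32 => ![0, a 0 * b 0, 0]
      | .J33 => ![0, 0, a 0 * b 1 + a 1 * b 0]
      | .J34 => ![0, a 0 * b 0, a 0 * b 1 + a 1 * b 0])
    (by intro a a' b; cases r <;> ext t <;> fin_cases t <;> simp <;> ring)
    (by intro c a b; cases r <;> ext t <;> fin_cases t <;> simp <;> ring)
    (by intro a b b'; cases r <;> ext t <;> fin_cases t <;> simp <;> ring)
    (by intro c a b; cases r <;> ext t <;> fin_cases t <;> simp <;> ring)

/-- The superalgebra on `ℂ³ ⊕ ℂ²`, with even basis `e₁, e₂, e₃` and odd basis `f₁, f₂`, whose even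
part is the algebra `r` and whose other products of basis vectors are
`eᵢf₂ = f₂eᵢ = δᵢ f₁` for `i = 1, 2, 3` and
`f₁f₂ = - f₂f₁ = ω₁e₁ + ω₂e₂ + ω₃e₃`, all remaining ones (`eᵢf₁`, `f₁eᵢ`, `f₁²`, `f₂²`)
being zero. -/
def model (r : EvenType) (δ ω : Fin 3 → ℂ) : Superalgebra ((Fin 3 → ℂ) × (Fin 2 → ℂ)) where
  mul := LinearMap.mk₂ ℂ
    (fun x y =>
      (evenMul r x.1 y.1 + (x.2 0 * y.2 1 - x.2 1 * y.2 0) • ω,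
        ![(∑ i, δ i * x.1 i) * y.2 1 + (∑ i, δ i * y.1 i) * x.2 1, 0]))
    (by
      intro x x' y
      ext t
      · simp; ring
      · fin_cases t <;> simp [Fin.sum_univ_three] <;> ring)
    (by
      intro c x y
      ext t
      · simp; ring
      · fin_cases t <;> simp [Fin.sum_univ_three] <;> ring)
    (by
      intro x y y'
      ext t
      · simp; ring
      · fin_cases t <;> simp [Fin.sum_univ_three] <;> ring)
    (by
      intro c x y
      ext t
      · simp; ring
      · fin_cases t <;> simp [Fin.sum_univ_three] <;> ring)
  part := fun i => if i = 0 then LinearMap.range (LinearMap.inl ℂ (Fin 3 → ℂ) (Fin 2 → ℂ))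
    else LinearMap.range (LinearMap.inr ℂ (Fin 3 → ℂ) (Fin 2 → ℂ))
  isCompl := by
    simpa using LinearMap.isCompl_range_inl_inr (R := ℂ) (M := Fin 3 → ℂ) (M₂ := Fin 2 → ℂ)
  mul_mem := by
    have h2 : ∀ i : ZMod 2, i = 0 ∨ i = 1 := by decide
    have h11 : (1 + 1 : ZMod 2) = 0 := by decide
    intro i j x y hx hy
    rcases h2 i with rfl | rfl <;> rcases h2 j with rfl | rfl <;>
      simp [LinearMap.range_inl, LinearMap.range_inr] at hx hy <;>
      simp [LinearMap.range_inl, LinearMap.range_inr, hx, hy, h11]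

/-- The even parts of `(3,2)₁, …, (3,2)₂₉`. -/
def evenType (n : Fin 29) : EvenType :=
  if n.val < 4 then .J31 else if n.val < 14 then .J32 else if n.val < 23 then .J33 else .J34

/-- The superalgebras `(3,2)₁, …, (3,2)₂₉`; the entry with index `n : Fin 29` is `(3,2)ₙ₊₁`. The
comments list the nonzero products of basis vectors, up to supercommutativity. -/
def table : Fin 29 → Superalgebra ((Fin 3 → ℂ) × (Fin 2 → ℂ)) :=
  ![
    -- (3,2)_1 : all products are zero
    model .J31 ![0, 0, 0] ![0, 0, 0],
    -- (3,2)_2 : f₁f₂ = e₂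
    model .J31 ![0, 0, 0] ![0, 1, 0],
    -- (3,2)_3 : e₁f₂ = f₁
    model .J31 ![1, 0, 0] ![0, 0, 0],
    -- (3,2)_4 : e₁f₂ = f₁, f₁f₂ = e₂
    model .J31 ![1, 0, 0] ![0, 1, 0],
    -- (3,2)_5 : e₁² = e₂
    model .J32 ![0, 0, 0] ![0, 0, 0],
    -- (3,2)_6 : e₁² = e₂, f₁f₂ = e₁
    model .J32 ![0, 0, 0] ![1, 0, 0],
    -- (3,2)_7 : e₁² = e₂, f₁f₂ = e₂
    model .J32 ![0, 0, 0] ![0, 1, 0],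
    -- (3,2)_8 : e₁² = e₂, f₁f₂ = e₃
    model .J32 ![0, 0, 0] ![0, 0, 1],
    -- (3,2)_9 : e₁² = e₂, e₂f₂ = f₁
    model .J32 ![0, 1, 0] ![0, 0, 0],
    -- (3,2)_10 : e₁² = e₂, e₃f₂ = f₁
    model .J32 ![0, 0, 1] ![0, 0, 0],
    -- (3,2)_11 : e₁² = e₂, e₃f₂ = f₁, f₁f₂ = e₂
    model .J32 ![0, 0, 1] ![0, 1, 0],
    -- (3,2)_12 : e₁² = e₂, e₁f₂ = f₁
    model .J32 ![1, 0, 0] ![0, 0, 0],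
    -- (3,2)_13 : e₁² = e₂, e₁f₂ = f₁, f₁f₂ = e₂
    model .J32 ![1, 0, 0] ![0, 1, 0],
    -- (3,2)_14 : e₁² = e₂, e₁f₂ = f₁, f₁f₂ = e₃
    model .J32 ![1, 0, 0] ![0, 0, 1],
    -- (3,2)_15 : e₁e₂ = e₃
    model .J33 ![0, 0, 0] ![0, 0, 0],
    -- (3,2)_16 : e₁e₂ = e₃, f₁f₂ = e₁
    model .J33 ![0, 0, 0] ![1, 0, 0],
    -- (3,2)_17 : e₁e₂ = e₃, f₁f₂ = e₃
    model .J33 ![0, 0, 0] ![0, 0, 1],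
    -- (3,2)_18 : e₁e₂ = e₃, f₁f₂ = e₁ + e₂
    model .J33 ![0, 0, 0] ![1, 1, 0],
    -- (3,2)_19 : e₁e₂ = e₃, e₃f₂ = f₁
    model .J33 ![0, 0, 1] ![0, 0, 0],
    -- (3,2)_20 : e₁e₂ = e₃, e₁f₂ = f₁
    model .J33 ![1, 0, 0] ![0, 0, 0],
    -- (3,2)_21 : e₁e₂ = e₃, e₁f₂ = f₁, f₁f₂ = e₃
    model .J33 ![1, 0, 0] ![0, 0, 1],
    -- (3,2)_22 : e₁e₂ = e₃, e₁f₂ = e₂f₂ = f₁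
    model .J33 ![1, 1, 0] ![0, 0, 0],
    -- (3,2)_23 : e₁e₂ = e₃, e₁f₂ = e₂f₂ = f₁, f₁f₂ = e₃
    model .J33 ![1, 1, 0] ![0, 0, 1],
    -- (3,2)_24 : e₁² = e₂, e₁e₂ = e₃
    model .J34 ![0, 0, 0] ![0, 0, 0],
    -- (3,2)_25 : e₁² = e₂, e₁e₂ = e₃, f₁f₂ = e₂
    model .J34 ![0, 0, 0] ![0, 1, 0],
    -- (3,2)_26 : e₁² = e₂, e₁e₂ = e₃, f₁f₂ = e₃
    model .J34 ![0, 0, 0] ![0, 0, 1],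
    -- (3,2)_27 : e₁² = e₂, e₁e₂ = e₃, e₂f₂ = f₁
    model .J34 ![0, 1, 0] ![0, 0, 0],
    -- (3,2)_28 : e₁² = e₂, e₁e₂ = e₃, e₁f₂ = f₁
    model .J34 ![1, 0, 0] ![0, 0, 0],
    -- (3,2)_29 : e₁² = e₂, e₁e₂ = e₃, e₁f₂ = f₁, f₁f₂ = e₃
    model .J34 ![1, 0, 0] ![0, 0, 1]]

end JordanSuper

/-! Nilpotency makes `J₀V` a proper subspace of every nonzero `J₀`-stable subspace `V` of finite
dimension. Flags built from this give `J₀` a basis with triangular multiplication and `J₁` a basis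
`f₁, f₂` with `J₀f₁ = 0` and `J₀f₂ ⊆ ℂf₁`. The Jordan identity reduces the even part to one of four
algebras `r`, and odd squares vanish by supercommutativity. What remains is a linear form `δ` with
`x f₂ = δ(x) f₁` and a vector `ω = f₁f₂`: every algebra in question is a `model r δ ω`
(`exists_iso_model`).

The Jordan superidentity, together with `δ(ω) = 0` (forced by nilpotency, as `(f₁f₂)f₂ = δ(ω)f₁`),
turns into the equations `Admissible` on `(r, δ, ω)`. These also suffice for the Jordan property.

Two models are isomorphic exactly when an isomorphism of the even parts carries one pair `(δ, ω)` to
the other up to two independent nonzero scalars (`equivalent_of_iso`, `iso_of_equivalent`); the odd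
part contributes only these scalars, and square roots in `ℂ` make them independent. The
classification is thus an orbit problem for admissible pairs. In each even type the equations kill
most coordinates, and explicit automorphisms bring the rest to a table entry.

Conversely, a grading by positive weights shows that each entry is nilpotent, and eight properties
stable under equivalence, together with the even type, separate the entries. -/

namespace JordanSuper

/-! ### Isomorphisms, powers and nilpotency -/

namespace Superalgebra

variable {J J' J'' : Type*} [AddCommGroup J] [Module ℂ J] [AddCommGroup J'] [Module ℂ J']
  [AddCommGroup J''] [Module ℂ J'']

theorem Iso.symm {A : Superalgebra J} {B : Superalgebra J'} (h : A.Iso B) : B.Iso A := by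
  obtain ⟨Φ, hm, hp⟩ := h
  refine ⟨Φ.symm, fun x y => ?_, fun i => ?_⟩
  · apply Φ.injective
    simp [hm]
  · rw [← hp i]
    ext x
    simp

theorem Iso.trans {A : Superalgebra J} {B : Superalgebra J'} {C : Superalgebra J''}
    (h : A.Iso B) (h' : B.Iso C) : A.Iso C := by
  obtain ⟨Φ, hm, hp⟩ := h
  obtain ⟨Ψ, hm', hp'⟩ := h'
  refine ⟨Φ.trans Ψ, fun x y => by simp [hm, hm'], fun i => ?_⟩
  rw [← hp' i, ← hp i]
  ext x
  simp

theorem Iso.isJordan {A : Superalgebra J} {B : Superalgebra J'} (h : A.Iso B)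
    (hA : A.IsJordan) : B.IsJordan := by
  obtain ⟨Φ, hm, hp⟩ := h
  constructor
  · intro i j x y hx hy
    rw [← hp] at hx hy
    obtain ⟨x, hx, rfl⟩ := hx
    obtain ⟨y, hy, rfl⟩ := hy
    have := congrArg Φ (hA.supercomm i j x y hx hy)
    simpa [hm] using this
  · intro i j k l x y z w hx hy hz hw
    rw [← hp] at hx hy hz hw
    obtain ⟨x, hx, rfl⟩ := hx
    obtain ⟨y, hy, rfl⟩ := hy
    obtain ⟨z, hz, rfl⟩ := hz
    obtain ⟨w, hw, rfl⟩ := hw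
    have := congrArg Φ (hA.superidentity i j k l x y z w hx hy hz hw)
    simpa [hm] using this

theorem power_succ_succ (A : Superalgebra J) (k : ℕ) : A.power (k + 2) =
    ⨆ i : Fin (k + 1), Submodule.map₂ A.mul (A.power (k + 1 - i)) (A.power (i + 1)) := by
  rw [power]

theorem power_one (A : Superalgebra J) : A.power 1 = ⊤ := by
  rw [power]

/-- Since `JᵏJ ⊆ Jᵏ⁺¹`, the inclusion `V ⊆ VJ` propagates `V ⊆ Jᵏ` to every `k`. -/
theorem IsNilpotent.eq_bot_of_le_left {A : Superalgebra J} (hA : A.IsNilpotent)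
    {V : Submodule ℂ J} (hV : V ≤ Submodule.map₂ A.mul V ⊤) : V = ⊥ := by
  have key : ∀ k, V ≤ A.power (k + 1) := by
    intro k
    induction k with
    | zero => rw [power_one]; exact le_top
    | succ k ih =>
      rw [power_succ_succ]
      refine hV.trans (le_trans ?_ (le_iSup _ (0 : Fin (k + 1))))
      simpa [power_one] using Submodule.map₂_le_map₂_left ih
  obtain ⟨k, hk, h⟩ := hA
  obtain ⟨k, rfl⟩ := Nat.exists_eq_succ_of_ne_zero hk.ne'
  exact le_bot_iff.1 (h ▸ key k)

theorem IsNilpotent.eq_bot_of_le_right {A : Superalgebra J} (hA : A.IsNilpotent)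
    {V : Submodule ℂ J} (hV : V ≤ Submodule.map₂ A.mul ⊤ V) : V = ⊥ := by
  have key : ∀ k, V ≤ A.power (k + 1) := by
    intro k
    induction k with
    | zero => rw [power_one]; exact le_top
    | succ k ih =>
      rw [power_succ_succ]
      refine hV.trans (le_trans ?_ (le_iSup _ (Fin.last k)))
      simpa [power_one] using Submodule.map₂_le_map₂_right ih
  obtain ⟨k, hk, h⟩ := hA
  obtain ⟨k, rfl⟩ := Nat.exists_eq_succ_of_ne_zero hk.ne'
  exact le_bot_iff.1 (h ▸ key k)

/-- The span `V` of `x` and `xy` satisfies `V ⊆ VJ`. Applied to `x = f₁`, `y = f₂`, this yields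
`δ(ω) = 0`. -/
theorem IsNilpotent.eq_zero_of_eq_smul_mul_mul {A : Superalgebra J} (hA : A.IsNilpotent)
    {x y : J} {c : ℂ} (h : x = c • A.mul (A.mul x y) y) : x = 0 := by
  have hV : Submodule.span ℂ {x, A.mul x y} = ⊥ := by
    apply hA.eq_bot_of_le_left
    rw [Submodule.span_le]
    have h1 : x ∈ Submodule.span ℂ {x, A.mul x y} := Submodule.subset_span (by simp)
    have h2 : A.mul x y ∈ Submodule.span ℂ {x, A.mul x y} := Submodule.subset_span (by simp)
    rintro z (rfl | rfl)
    · have := Submodule.smul_mem _ c (Submodule.apply_mem_map₂ A.mul h2 (Submodule.mem_top (x := y)))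
      rwa [← h] at this
    · exact Submodule.apply_mem_map₂ A.mul h1 Submodule.mem_top
  have : x ∈ Submodule.span ℂ {x, A.mul x y} := Submodule.subset_span (by simp)
  rwa [hV, Submodule.mem_bot] at this

/-- A multiplicative filtration that starts with the whole algebra and reaches zero. -/
theorem isNilpotent_of_filtration (A : Superalgebra J) (F : ℕ → Submodule ℂ J) (h1 : F 1 = ⊤)
    (hF : ∀ i j x y, x ∈ F i → y ∈ F j → A.mul x y ∈ F (i + j)) {N : ℕ} (hN : 0 < N)
    (hbot : F N = ⊥) : A.IsNilpotent := by
  have key : ∀ k, A.power (k + 1) ≤ F (k + 1) := by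
    intro k
    induction k using Nat.strong_induction_on with
    | _ k ih =>
      rcases k with _ | k
      · rw [zero_add, h1]; exact le_top
      · rw [power_succ_succ]
        refine iSup_le fun i => Submodule.map₂_le.2 fun x hx y hy => ?_
        have hi := i.isLt
        obtain ⟨j, hj⟩ : ∃ j, k = i + j := ⟨k - i, by omega⟩
        have e1 : k + 1 - (i : ℕ) = j + 1 := by omega
        rw [e1] at hx
        have := hF _ _ _ _ (ih j (by omega) hx) (ih i (by omega) hy)
        rwa [show j + 1 + ((i : ℕ) + 1) = k + 1 + 1 by omega] at this
  obtain ⟨k, rfl⟩ := Nat.exists_eq_succ_of_ne_zero hN.ne'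
  exact ⟨k + 1, hN, le_bot_iff.1 (hbot ▸ key k)⟩

end Superalgebra

end JordanSuper

/-! ### The models: Jordan identity and nilpotency -/

namespace JordanSuper

open Superalgebra

theorem evenMul_comm (r : EvenType) (a b : Fin 3 → ℂ) : evenMul r a b = evenMul r b a := by
  cases r <;> ext t <;> fin_cases t <;> simp [evenMul] <;> ring

theorem evenMul_jordan (r : EvenType) (x y z w : Fin 3 → ℂ) :
    evenMul r (evenMul r w x) (evenMul r y z) + evenMul r (evenMul r w y) (evenMul r x z)
      + evenMul r (evenMul r w z) (evenMul r x y) - evenMul r x (evenMul r w (evenMul r y z))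
      - evenMul r y (evenMul r w (evenMul r x z))
      - evenMul r z (evenMul r w (evenMul r x y)) = 0 := by
  cases r <;> ext t <;> fin_cases t <;> simp [evenMul]

/-- The linear form with coefficients `δ`. -/
def form (δ : Fin 3 → ℂ) : (Fin 3 → ℂ) →ₗ[ℂ] ℂ where
  toFun x := ∑ i, δ i * x i
  map_add' x y := by simp [mul_add, Finset.sum_add_distrib]
  map_smul' c x := by simp [Finset.mul_sum, mul_left_comm]

theorem form_apply (δ x : Fin 3 → ℂ) : form δ x = δ 0 * x 0 + δ 1 * x 1 + δ 2 * x 2 := by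
  simp [form, Fin.sum_univ_three]

variable (r : EvenType) (δ ω : Fin 3 → ℂ)

theorem model_mul (x y : (Fin 3 → ℂ) × (Fin 2 → ℂ)) : (model r δ ω).mul x y =
    (evenMul r x.1 y.1 + (x.2 0 * y.2 1 - x.2 1 * y.2 0) • ω,
        ![form δ x.1 * y.2 1 + form δ y.1 * x.2 1, 0]) := rfl

theorem mem_model_zero (x : (Fin 3 → ℂ) × (Fin 2 → ℂ)) :
    x ∈ (model r δ ω).part 0 ↔ ∃ a, x = (a, 0) := by
  simp only [model, if_true, LinearMap.mem_range, LinearMap.inl_apply]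
  exact ⟨fun ⟨a, h⟩ => ⟨a, h.symm⟩, fun ⟨a, h⟩ => ⟨a, h.symm⟩⟩

theorem mem_model_one (x : (Fin 3 → ℂ) × (Fin 2 → ℂ)) :
    x ∈ (model r δ ω).part 1 ↔ ∃ a, x = (0, a) := by
  simp only [model, one_ne_zero, if_false, LinearMap.mem_range, LinearMap.inr_apply]
  exact ⟨fun ⟨a, h⟩ => ⟨a, h.symm⟩, fun ⟨a, h⟩ => ⟨a, h.symm⟩⟩

/-- The conditions on `δ` and `ω` under which `model r δ ω` is a Jordan superalgebra whose odd part
generates a nilpotent subalgebra. -/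
structure Admissible : Prop where
  form_cube : ∀ x y z, form δ (evenMul r x (evenMul r y z)) = 0
  mul_sq : ∀ y z, evenMul r ω (evenMul r y z) = 0
  mul_mul : ∀ y z, evenMul r y (evenMul r z ω) = 0
  form_self : form δ ω = 0
  deriv : ∀ y z, form δ z • evenMul r y ω + form δ y • evenMul r z ω =
    form δ (evenMul r y z) • ω

theorem sgn_zero : sgn 0 = 1 := by simp [sgn]
theorem sgn_one : sgn 1 = -1 := by
  simp [sgn, ZMod.val_one]

variable {r δ ω}

theorem model_mul_even_even (a b : Fin 3 → ℂ) : (model r δ ω).mul (a, 0) (b, 0) = (evenMul r a b, 0) := by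
  rw [model_mul]; ext t
  · simp
  · fin_cases t <;> simp
theorem model_mul_even_odd (a : Fin 3 → ℂ) (p : Fin 2 → ℂ) :
    (model r δ ω).mul (a, 0) (0, p) = (0, ![form δ a * p 1, 0]) := by
  rw [model_mul]; ext t
  · simp
  · fin_cases t <;> simp
theorem model_mul_odd_even (a : Fin 3 → ℂ) (p : Fin 2 → ℂ) :
    (model r δ ω).mul (0, p) (a, 0) = (0, ![form δ a * p 1, 0]) := by
  rw [model_mul]; ext t
  · simp
  · fin_cases t <;> simp
theorem model_mul_odd_odd (p q : Fin 2 → ℂ) :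
    (model r δ ω).mul (0, p) (0, q) = ((p 0 * q 1 - p 1 * q 0) • ω, 0) := by
  rw [model_mul]; ext t
  · simp
  · fin_cases t <;> simp

/-- A check over the parities. With all arguments even it is the Jordan identity of `r`; with `w`
and one other argument odd it is a multiple of `deriv`; elsewhere the terms vanish or cancel by the
remaining conditions and signs. -/
theorem Admissible.isJordan (h : Admissible r δ ω) : (model r δ ω).IsJordan := by
  have h2 : ∀ i : ZMod 2, i = 0 ∨ i = 1 := by decide
  have h11 : (1 + 1 : ZMod 2) = 0 := by decide
  have hd : ∀ y z t, form δ z * evenMul r ω y t + form δ y * evenMul r ω z t =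
      form δ (evenMul r y z) * ω t := by
    intro y z t
    simpa [evenMul_comm r _ ω] using congrFun (h.deriv y z) t
  constructor
  · intro i j x y hx hy
    rcases h2 i with rfl | rfl <;> rcases h2 j with rfl | rfl <;>
      simp only [mem_model_zero, mem_model_one] at hx hy <;>
      obtain ⟨x, rfl⟩ := hx <;> obtain ⟨y, rfl⟩ := hy <;>
      simp only [model_mul_even_even, model_mul_even_odd, model_mul_odd_even, model_mul_odd_odd, mul_zero, mul_one, sgn_zero, sgn_one, one_smul]
    · rw [evenMul_comm]
    · ext t
      · simp; ring
      · simp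
  · intro i j k l x y z w hx hy hz hw
    rcases h2 i with rfl | rfl <;> rcases h2 j with rfl | rfl <;>
      rcases h2 k with rfl | rfl <;> rcases h2 l with rfl | rfl <;>
      simp only [mem_model_zero, mem_model_one] at hx hy hz hw <;>
      obtain ⟨x, rfl⟩ := hx <;> obtain ⟨y, rfl⟩ := hy <;>
      obtain ⟨z, rfl⟩ := hz <;> obtain ⟨w, rfl⟩ := hw <;>
      simp only [model_mul_even_even, model_mul_even_odd, model_mul_odd_even, model_mul_odd_odd, mul_zero, zero_mul, mul_one, add_zero, zero_add, h11, sgn_zero,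
        sgn_one, one_smul, map_smul, LinearMap.smul_apply, h.form_cube, h.mul_sq, h.mul_mul,
        h.form_self] <;>
      refine Prod.ext (funext fun t => ?_) (funext fun s => ?_)
    all_goals try fin_cases s
    all_goals simp [evenMul_comm r _ ω, h.mul_sq]
    all_goals first
      | ring1
      | exact congrFun (evenMul_jordan r x y z w) t
      | linear_combination w 1 * z 1 * hd x y t
      | linear_combination w 1 * y 1 * hd x z t
      | linear_combination w 1 * x 1 * hd y z t

/-- The indices of the structure constants of an even type add up in the grading by weights `a`. -/
def EvenType.Weights (a : Fin 3 → ℕ) : EvenType → Prop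
  | .J31 => True
  | .J32 => a 0 + a 0 ≤ a 1
  | .J33 => a 0 + a 1 ≤ a 2
  | .J34 => a 0 + a 0 ≤ a 1 ∧ a 0 + a 1 ≤ a 2

theorem evenMul_eq_zero_of_weights {a : Fin 3 → ℕ} (h : r.Weights a) {i j : ℕ} {x y : Fin 3 → ℂ}
    (hx : ∀ t, a t < i → x t = 0) (hy : ∀ t, a t < j → y t = 0) (t : Fin 3) (ht : a t < i + j) :
    evenMul r x y t = 0 := by
  have key : ∀ u v, a u + a v ≤ a t → x u * y v = 0 := by
    intro u v huv
    rcases lt_or_ge (a u) i with hu | hu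
    · simp [hx u hu]
    · simp [hy v (by omega)]
  cases r <;> simp only [EvenType.Weights] at h <;> fin_cases t <;> simp [evenMul]
  · simpa using key 0 0 h
  · have h1 := key 0 1 h
    have h2 := key 1 0 ((add_comm _ _).trans_le h)
    rw [h1, h2, add_zero]
  · simpa using key 0 0 h.1
  · have h1 := key 0 1 h.2
    have h2 := key 1 0 ((add_comm _ _).trans_le h.2)
    rw [h1, h2, add_zero]

/-- Give `eᵢ` weight `a i` and `fⱼ` weight `b j`. The hypotheses say that no product of basis
vectors has a component of weight below the sum of the weights, so the spans of basis vectors of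
weight at least `k` form a multiplicative filtration. -/
theorem model_isNilpotent_of_weights (a : Fin 3 → ℕ) (b : Fin 2 → ℕ) (ha : ∀ i, 1 ≤ a i)
    (hb : ∀ i, 1 ≤ b i) (hr : r.Weights a) (hδ : ∀ i, δ i = 0 ∨ a i + b 1 ≤ b 0)
    (hω : ∀ i, ω i = 0 ∨ b 0 + b 1 ≤ a i) : (model r δ ω).IsNilpotent := by
  let F : ℕ → Submodule ℂ ((Fin 3 → ℂ) × (Fin 2 → ℂ)) := fun k =>
    { carrier := {x | (∀ i, a i < k → x.1 i = 0) ∧ ∀ i, b i < k → x.2 i = 0}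
      add_mem' := fun {x y} hx hy => ⟨fun i hi => by simp [hx.1 i hi, hy.1 i hi],
        fun i hi => by simp [hx.2 i hi, hy.2 i hi]⟩
      zero_mem' := ⟨fun _ _ => rfl, fun _ _ => rfl⟩
      smul_mem' := fun c x hx => ⟨fun i hi => by simp [hx.1 i hi],
        fun i hi => by simp [hx.2 i hi]⟩ }
  have hF : ∀ k x, x ∈ F k ↔ (∀ i, a i < k → x.1 i = 0) ∧ ∀ i, b i < k → x.2 i = 0 :=
    fun _ _ => Iff.rfl
  -- The chosen `N` exceeds every single weight, so the filtration vanishes there.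
  refine isNilpotent_of_filtration (model r δ ω) F ?_ ?_ (N := ∑ i, a i + ∑ i, b i + 1) (by omega) ?_
  · rw [eq_top_iff]
    intro x _
    rw [hF]
    exact ⟨fun i hi => by have := ha i; omega, fun i hi => by have := hb i; omega⟩
  · intro i j x y hx hy
    rw [hF] at hx hy ⊢
    have hf : ∀ {u v : ℕ} {p : Fin 3 → ℂ} {q : Fin 2 → ℂ}, (∀ t, a t < u → p t = 0) →
        (∀ t, b t < v → q t = 0) → b 0 < u + v → form δ p * q 1 = 0 := by
      intro u v p q hp hq huv
      rcases lt_or_ge (b 1) v with h | h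
      · simp [hq 1 h]
      · have : form δ p = 0 := by
          change ∑ t, δ t * p t = 0
          refine Finset.sum_eq_zero fun t _ => ?_
          rcases hδ t with h' | h'
          · simp [h']
          · simp [hp t (by omega)]
        simp [this]
    refine ⟨fun t ht => ?_, fun t ht => ?_⟩
    · have h1 := evenMul_eq_zero_of_weights hr hx.1 hy.1 t ht
      have h2 : (x.2 0 * y.2 1 - x.2 1 * y.2 0) * ω t = 0 := by
        rcases hω t with h | h
        · simp [h]
        · have h3 : x.2 0 * y.2 1 = 0 := by
            rcases lt_or_ge (b 0) i with h' | h'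
            · simp [hx.2 0 h']
            · simp [hy.2 1 (by omega)]
          have h4 : x.2 1 * y.2 0 = 0 := by
            rcases lt_or_ge (b 1) i with h' | h'
            · simp [hx.2 1 h']
            · simp [hy.2 0 (by omega)]
          simp [h3, h4]
      simp [model_mul, h1, h2]
    · fin_cases t
      · simp [model_mul, hf hx.1 hy.2 ht, hf hy.1 hx.2 (ht.trans_eq (add_comm i j))]
      · simp [model_mul]
  · rw [eq_bot_iff]
    intro x hx
    rw [hF] at hx
    rw [Submodule.mem_bot]
    refine Prod.ext (funext fun i => hx.1 i ?_) (funext fun i => hx.2 i ?_)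
    · have := Finset.single_le_sum (f := a) (fun _ _ => Nat.zero_le _) (Finset.mem_univ i)
      omega
    · have := Finset.single_le_sum (f := b) (fun _ _ => Nat.zero_le _) (Finset.mem_univ i)
      omega

theorem model_hasType (r : EvenType) (δ ω : Fin 3 → ℂ) : (model r δ ω).HasType 3 2 := by
  refine ⟨inferInstance, ?_, ?_⟩
  · change Module.finrank ℂ (LinearMap.range (LinearMap.inl ℂ (Fin 3 → ℂ) (Fin 2 → ℂ))) = 3
    rw [LinearMap.finrank_range_of_inj LinearMap.inl_injective]
    simp
  · change Module.finrank ℂ (LinearMap.range (LinearMap.inr ℂ (Fin 3 → ℂ) (Fin 2 → ℂ))) = 2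
    rw [LinearMap.finrank_range_of_inj LinearMap.inr_injective]
    simp

/-! ### The 29 entries as models -/

/-- The linear forms `δ` of the entries of `table`. -/
def tableForm : Fin 29 → Fin 3 → ℂ :=
  ![0, 0, ![1, 0, 0], ![1, 0, 0],
    0, 0, 0, 0, ![0, 1, 0], ![0, 0, 1], ![0, 0, 1], ![1, 0, 0], ![1, 0, 0], ![1, 0, 0],
    0, 0, 0, 0, ![0, 0, 1], ![1, 0, 0], ![1, 0, 0], ![1, 1, 0], ![1, 1, 0],
    0, 0, 0, ![0, 1, 0], ![1, 0, 0], ![1, 0, 0]]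

/-- The vectors `ω` of the entries of `table`. -/
def tableVec : Fin 29 → Fin 3 → ℂ :=
  ![0, ![0, 1, 0], 0, ![0, 1, 0],
    0, ![1, 0, 0], ![0, 1, 0], ![0, 0, 1], 0, 0, ![0, 1, 0], 0, ![0, 1, 0], ![0, 0, 1],
    0, ![1, 0, 0], ![0, 0, 1], ![1, 1, 0], 0, 0, ![0, 0, 1], 0, ![0, 0, 1],
    0, ![0, 1, 0], ![0, 0, 1], 0, 0, ![0, 0, 1]]

theorem table_eq (n : Fin 29) : table n = model (evenType n) (tableForm n) (tableVec n) := by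
  have h0 : (![0, 0, 0] : Fin 3 → ℂ) = 0 := by ext i; fin_cases i <;> rfl
  fin_cases n <;> simp [table, tableForm, tableVec, evenType, h0]

theorem table_admissible (n : Fin 29) :
    Admissible (evenType n) (tableForm n) (tableVec n) := by
  constructor
  · intro x y z
    fin_cases n <;> simp [tableForm, evenType, evenMul, form_apply]
  · intro y z
    fin_cases n <;> ext t <;> fin_cases t <;> simp [tableVec, evenType, evenMul]
  · intro y z
    fin_cases n <;> ext t <;> fin_cases t <;> simp [tableVec, evenType, evenMul]
  · fin_cases n <;> simp [tableVec, tableForm, form_apply]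
  · intro y z
    fin_cases n <;> ext t <;> fin_cases t <;>
      simp [tableVec, tableForm, evenType, evenMul, form_apply]

theorem table_isNilpotent (n : Fin 29) : (table n).IsNilpotent := by
  rw [table_eq]
  have key : ∃ (a : Fin 3 → ℕ) (b : Fin 2 → ℕ), (∀ i, 1 ≤ a i) ∧ (∀ i, 1 ≤ b i) ∧
      (evenType n).Weights a ∧ (∀ i, tableForm n i = 0 ∨ a i + b 1 ≤ b 0) ∧
      (∀ i, tableVec n i = 0 ∨ b 0 + b 1 ≤ a i) := by
    -- Five weight systems cover the whole table; each entry takes the first that fits.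
    fin_cases n <;> simp only [evenType, tableForm, tableVec] <;> first
      | (refine ⟨![2, 4, 6], ![1, 1], ?_⟩; simp [Fin.forall_fin_succ, EvenType.Weights]; done)
      | (refine ⟨![1, 3, 4], ![2, 1], ?_⟩; simp [Fin.forall_fin_succ, EvenType.Weights]; done)
      | (refine ⟨![1, 2, 4], ![3, 1], ?_⟩; simp [Fin.forall_fin_succ, EvenType.Weights]; done)
      | (refine ⟨![1, 2, 3], ![4, 1], ?_⟩; simp [Fin.forall_fin_succ, EvenType.Weights]; done)
      | (refine ⟨![1, 3, 1], ![2, 1], ?_⟩; simp [Fin.forall_fin_succ, EvenType.Weights]; done)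
  obtain ⟨a, b, h1, h2, h3, h4, h5⟩ := key
  exact model_isNilpotent_of_weights a b h1 h2 h3 h4 h5

end JordanSuper

/-! ### Isomorphisms of models -/

namespace JordanSuper

open Superalgebra

/-- An isomorphism of even parts `T` for which `δ' ∘ T = s δ` and `T ω = t ω'` up to nonzero
scalars `s, t`. -/
def Equivalent (r : EvenType) (δ ω : Fin 3 → ℂ) (r' : EvenType) (δ' ω' : Fin 3 → ℂ) : Prop :=
  ∃ (T : (Fin 3 → ℂ) ≃ₗ[ℂ] (Fin 3 → ℂ)) (s t : ℂ), s ≠ 0 ∧ t ≠ 0 ∧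
    (∀ x y, T (evenMul r x y) = evenMul r' (T x) (T y)) ∧
    (∀ x, form δ' (T x) = s * form δ x) ∧ T ω = t • ω'

variable {r r' : EvenType} {δ ω δ' ω' : Fin 3 → ℂ}

/-- An isomorphism splits into an even map `T` and an odd map `G`. As `f₁f₂` is alternating in the
odd vectors, `t = det G`. If `G` preserves the line `ℂf₁`, then `s` is the ratio of its diagonal
entries. -/
theorem equivalent_of_iso (h : (model r δ ω).Iso (model r' δ' ω')) :
    Equivalent r δ ω r' δ' ω' := by
  obtain ⟨Φ, hm, hp⟩ := h
  have hE : ∀ a, ∃ b, Φ (a, 0) = (b, 0) := fun a => by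
    rw [← mem_model_zero r' δ' ω', ← hp 0]
    exact ⟨_, (mem_model_zero r δ ω _).2 ⟨a, rfl⟩, rfl⟩
  have hE' : ∀ a, ∃ b, Φ.symm (a, 0) = (b, 0) := fun a => by
    have : ((a, 0) : (Fin 3 → ℂ) × (Fin 2 → ℂ)) ∈ (model r' δ' ω').part 0 :=
      (mem_model_zero _ _ _ _).2 ⟨a, rfl⟩
    rw [← hp 0] at this
    obtain ⟨x, hx, h⟩ := this
    rw [← h]
    simpa using (mem_model_zero _ _ _ _).1 hx
  have hO : ∀ a, ∃ b, Φ (0, a) = (0, b) := fun a => by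
    rw [← mem_model_one r' δ' ω', ← hp 1]
    exact ⟨_, (mem_model_one r δ ω _).2 ⟨a, rfl⟩, rfl⟩
  have hO' : ∀ a, ∃ b, Φ.symm (0, a) = (0, b) := fun a => by
    have : ((0, a) : (Fin 3 → ℂ) × (Fin 2 → ℂ)) ∈ (model r' δ' ω').part 1 :=
      (mem_model_one _ _ _ _).2 ⟨a, rfl⟩
    rw [← hp 1] at this
    obtain ⟨x, hx, h⟩ := this
    rw [← h]
    simpa using (mem_model_one _ _ _ _).1 hx
  let T : (Fin 3 → ℂ) ≃ₗ[ℂ] (Fin 3 → ℂ) :=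
    { toFun := fun a => (Φ (a, 0)).1
      invFun := fun a => (Φ.symm (a, 0)).1
      map_add' := fun a b => by
        have : ((a + b, 0) : (Fin 3 → ℂ) × (Fin 2 → ℂ)) = (a, 0) + (b, 0) := by simp
        rw [this, map_add]; rfl
      map_smul' := fun c a => by
        have : ((c • a, 0) : (Fin 3 → ℂ) × (Fin 2 → ℂ)) = c • (a, 0) := by simp
        rw [this, map_smul]; rfl
      left_inv := fun a => by
        obtain ⟨b, hb⟩ := hE a
        simp only [hb]
        rw [← hb, LinearEquiv.symm_apply_apply]
      right_inv := fun a => by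
        obtain ⟨b, hb⟩ := hE' a
        simp only [hb]
        rw [← hb, LinearEquiv.apply_symm_apply] }
  have hT : ∀ a, Φ (a, 0) = (T a, 0) := fun a => by
    obtain ⟨b, hb⟩ := hE a
    have : T a = (Φ (a, 0)).1 := rfl
    rw [this, hb]
  let G : (Fin 2 → ℂ) → (Fin 2 → ℂ) := fun a => (Φ (0, a)).2
  have hG : ∀ a, Φ (0, a) = (0, G a) := fun a => by
    obtain ⟨b, hb⟩ := hO a
    have : G a = (Φ (0, a)).2 := rfl
    rw [this, hb]
  have hGs : ∀ b, ∃ a, G a = b := fun b => by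
    obtain ⟨a, ha⟩ := hO' b
    refine ⟨a, ?_⟩
    have := hG a
    rw [← ha, LinearEquiv.apply_symm_apply] at this
    exact (congrArg Prod.snd this).symm
  have hGl : ∀ (c : ℂ) a, G (c • a) = c • G a := fun c a => by
    have : ((0, c • a) : (Fin 3 → ℂ) × (Fin 2 → ℂ)) = c • (0, a) := by simp
    change (Φ (0, c • a)).2 = c • (Φ (0, a)).2
    rw [this, map_smul]; rfl
  have hGa : ∀ a b, G (a + b) = G a + G b := fun a b => by
    have : ((0, a + b) : (Fin 3 → ℂ) × (Fin 2 → ℂ)) = (0, a) + (0, b) := by simp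
    change (Φ (0, a + b)).2 = (Φ (0, a)).2 + (Φ (0, b)).2
    rw [this, map_add]; rfl
  set g₁ := G ![1, 0] with hg₁
  set g₂ := G ![0, 1] with hg₂
  have hGe : ∀ a, G a = a 0 • g₁ + a 1 • g₂ := fun a => by
    rw [hg₁, hg₂, ← hGl, ← hGl, ← hGa]
    congr 1
    ext i; fin_cases i <;> simp
  have hmul : ∀ x y, T (evenMul r x y) = evenMul r' (T x) (T y) := fun x y => by
    have := hm (x, 0) (y, 0)
    rw [model_mul_even_even, hT, hT, hT, model_mul_even_even] at this
    exact congrArg Prod.fst this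
  have hact : ∀ x p, (form δ x * p 1) • g₁ = ![form δ' (T x) * G p 1, 0] := fun x p => by
    have := hm (x, 0) (0, p)
    rw [model_mul_even_odd, hG, hT, hG, model_mul_even_odd] at this
    have := congrArg Prod.snd this
    simpa [hGe] using this
  have hdet : T ω = (g₁ 0 * g₂ 1 - g₁ 1 * g₂ 0) • ω' := by
    have := hm (0, ![1, 0]) (0, ![0, 1])
    rw [model_mul_odd_odd, hG, hT, hG, model_mul_odd_odd] at this
    simpa using congrArg Prod.fst this
  have hne : g₁ 0 * g₂ 1 - g₁ 1 * g₂ 0 ≠ 0 := by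
    intro h0
    obtain ⟨a, ha⟩ := hGs ![1, 0]
    obtain ⟨b, hb⟩ := hGs ![0, 1]
    rw [hGe] at ha hb
    have a0 := congrFun ha 0
    have a1 := congrFun ha 1
    have b0 := congrFun hb 0
    have b1 := congrFun hb 1
    simp at a0 a1 b0 b1
    -- The preimages `a, b` of the basis form the inverse matrix of `G`, so the determinants
    -- multiply to 1.
    have : (a 0 * b 1 - a 1 * b 0) * (g₁ 0 * g₂ 1 - g₁ 1 * g₂ 0) = 1 := by
      linear_combination (b 0 * g₁ 1 + b 1 * g₂ 1) * a0 - (b 0 * g₁ 0 + b 1 * g₂ 0) * a1 + b1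
    rw [h0, mul_zero] at this
    exact zero_ne_one this
  have h11 : ∀ x, form δ x * g₁ 0 = form δ' (T x) * g₂ 1 := fun x => by
    have := congrFun (hact x ![0, 1]) 0
    simpa [hGe] using this
  have h12 : ∀ x, form δ x * g₁ 1 = 0 := fun x => by
    have := congrFun (hact x ![0, 1]) 1
    simpa [hGe] using this
  have h13 : ∀ x, form δ' (T x) * g₁ 1 = 0 := fun x => by
    have := congrFun (hact x ![1, 0]) 0
    simpa [hGe] using this.symm
  -- If `G` moves `f₁` off its line, both forms vanish and any nonzero `s` will do.
  by_cases hz : g₁ 1 = 0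
  · have h1 : g₁ 0 ≠ 0 := fun h => hne (by simp [h, hz])
    have h2 : g₂ 1 ≠ 0 := fun h => hne (by simp [h, hz])
    refine ⟨T, g₁ 0 / g₂ 1, _, div_ne_zero h1 h2, hne, hmul, fun x => ?_, hdet⟩
    field_simp
    linear_combination -h11 x
  · refine ⟨T, 1, _, one_ne_zero, hne, hmul, fun x => ?_, hdet⟩
    have e1 := (mul_eq_zero.1 (h12 x)).resolve_right hz
    have e2 := (mul_eq_zero.1 (h13 x)).resolve_right hz
    rw [e1, e2, mul_zero]

/-- The odd map may be diagonal, with entries of ratio `s` and product `t`: take `sd` and `d` with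
`d² = t/s`. -/
theorem iso_of_equivalent (h : Equivalent r δ ω r' δ' ω') :
    (model r δ ω).Iso (model r' δ' ω') := by
  obtain ⟨T, s, t, hs, ht, hm, hδ, hω⟩ := h
  obtain ⟨d, hd⟩ := IsAlgClosed.exists_pow_nat_eq (t / s) (n := 2) (by norm_num)
  have hd0 : d ≠ 0 := by
    rintro rfl
    have := div_ne_zero ht hs
    simp [← hd] at this
  have hsd : s * d ≠ 0 := mul_ne_zero hs hd0
  have hst : s * d * d = t := by
    field_simp at hd
    linear_combination hd
  let G : (Fin 2 → ℂ) ≃ₗ[ℂ] (Fin 2 → ℂ) :=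
    { toFun := fun a => ![s * d * a 0, d * a 1]
      invFun := fun a => ![(s * d)⁻¹ * a 0, d⁻¹ * a 1]
      map_add' := fun a b => by ext i; fin_cases i <;> simp [mul_add]
      map_smul' := fun e a => by ext i; fin_cases i <;> simp [mul_left_comm]
      left_inv := fun a => by ext i; fin_cases i <;> simp <;> field_simp
      right_inv := fun a => by ext i; fin_cases i <;> simp <;> field_simp }
  have hG : ∀ a, G a = ![s * d * a 0, d * a 1] := fun _ => rfl
  refine ⟨T.prodCongr G, fun x y => ?_, fun i => ?_⟩
  · rw [model_mul, model_mul]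
    simp only [LinearEquiv.prodCongr_apply, map_add, map_smul, hm, hω, hG, hδ]
    refine Prod.ext ?_ ?_
    · simp only [← hst, smul_smul, Matrix.cons_val_zero, Matrix.cons_val_one]
      congr 2
      ring
    · ext i; fin_cases i <;> simp <;> ring
  · have h2 : ∀ i : ZMod 2, i = 0 ∨ i = 1 := by decide
    ext x
    simp only [Submodule.mem_map]
    rcases h2 i with rfl | rfl
    · simp only [mem_model_zero]
      constructor
      · rintro ⟨_, ⟨a, rfl⟩, rfl⟩
        exact ⟨T a, by simp⟩
      · rintro ⟨a, rfl⟩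
        exact ⟨_, ⟨T.symm a, rfl⟩, by simp⟩
    · simp only [mem_model_one]
      constructor
      · rintro ⟨_, ⟨a, rfl⟩, rfl⟩
        exact ⟨G a, by simp⟩
      · rintro ⟨a, rfl⟩
        exact ⟨_, ⟨G.symm a, rfl⟩, by simp⟩

/-! ### Invariants of the even part -/

/-- Properties of an algebra that distinguish the four even types. -/
def evenInvariant (r : EvenType) : Fin 3 → Prop :=
  ![∀ x y, evenMul r x y = 0, ∀ x y z, evenMul r x (evenMul r y z) = 0,
    ∀ x y, evenMul r x x = 0 → evenMul r y y = 0 → evenMul r x y = 0]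

theorem evenInvariant_of_equiv (T : (Fin 3 → ℂ) ≃ₗ[ℂ] (Fin 3 → ℂ))
    (hT : ∀ x y, T (evenMul r x y) = evenMul r' (T x) (T y)) (i : Fin 3)
    (h : evenInvariant r i) : evenInvariant r' i := by
  have h0 : ∀ x, T x = 0 ↔ x = 0 := fun x => T.map_eq_zero_iff
  fin_cases i
  · intro x y
    obtain ⟨x, rfl⟩ := T.surjective x
    obtain ⟨y, rfl⟩ := T.surjective y
    rw [← hT, h0]
    exact h x y
  · intro x y z
    obtain ⟨x, rfl⟩ := T.surjective x
    obtain ⟨y, rfl⟩ := T.surjective y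
    obtain ⟨z, rfl⟩ := T.surjective z
    rw [← hT, ← hT, h0]
    exact h x y z
  · intro x y
    obtain ⟨x, rfl⟩ := T.surjective x
    obtain ⟨y, rfl⟩ := T.surjective y
    rw [← hT, ← hT, ← hT, h0, h0, h0]
    exact h x y

theorem eq_zero_iff_coord (v : Fin 3 → ℂ) : v = 0 ↔ v 0 = 0 ∧ v 1 = 0 ∧ v 2 = 0 := by
  rw [funext_iff, Fin.forall_fin_succ, Fin.forall_fin_succ, Fin.forall_fin_succ]; simp

/-- The four rows differ: only `J31` has zero product, only `J34` has a nonzero triple product,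
namely `e₁(e₁e₁)`, and only `J33` has two square-zero elements with nonzero product. -/
theorem evenInvariant_iff (r : EvenType) (i : Fin 3) : evenInvariant r i ↔
    (match r with
      | .J31 => ![true, true, true]
      | .J32 => ![false, true, true]
      | .J33 => ![false, true, false]
      | .J34 => ![false, false, true]) i = true := by
  fin_cases i <;> cases r <;> simp [evenInvariant, evenMul]
  · exact ⟨![1, 0, 0], by simp⟩
  · exact ⟨![1, 0, 0], ![0, 1, 0], by simp⟩
  · exact ⟨![1, 0, 0], ![0, 1, 0], by simp⟩
  · exact ⟨![1, 0, 0], by simp⟩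
  · intro x y hx _
    exact Or.inl hx
  · exact ⟨![1, 0, 0], by simp, ![0, 1, 0], by simp⟩
  · intro x y hx _ hy _
    simp [hx, hy]

theorem evenType_eq_of_equiv (T : (Fin 3 → ℂ) ≃ₗ[ℂ] (Fin 3 → ℂ))
    (hT : ∀ x y, T (evenMul r x y) = evenMul r' (T x) (T y)) : r = r' := by
  have hT' : ∀ x y, T.symm (evenMul r' x y) = evenMul r (T.symm x) (T.symm y) := fun x y => by
    apply T.injective
    simp [hT]
  have h := fun i => (evenInvariant_iff r i).symm.trans
    (Iff.trans ⟨evenInvariant_of_equiv T hT i, evenInvariant_of_equiv T.symm hT' i⟩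
      (evenInvariant_iff r' i))
  have h0 := h 0
  have h1 := h 1
  have h2 := h 2
  clear h
  cases r <;> cases r' <;> first | rfl | simp at h0 h1 h2

/-! ### Invariants of the pair `(δ, ω)` -/

/-- Properties of `(r, δ, ω)` that are preserved by equivalence. -/
def invariant (r : EvenType) (δ ω : Fin 3 → ℂ) : Fin 8 → Prop :=
  ![∀ x, form δ x = 0,
    ω = 0,
    ∀ x, evenMul r x ω = 0,
    ∃ x y, evenMul r x y = ω,
    ∀ x y, form δ (evenMul r x y) = 0,
    ∀ x, (∀ y, evenMul r y x = 0) → form δ x = 0,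
    evenMul r ω ω = 0,
    ∀ x, form δ x = 0 → evenMul r x x = 0]

/-- Each property is insensitive to rescaling `δ` and `ω`, so it transports along `T`. -/
theorem invariant_of_equivalent (h : Equivalent r δ ω r' δ' ω') (i : Fin 8)
    (hi : invariant r δ ω i) : invariant r' δ' ω' i := by
  obtain ⟨T, s, t, hs, ht, hm, hδ, hω⟩ := h
  have h0 : ∀ x, T x = 0 ↔ x = 0 := fun x => T.map_eq_zero_iff
  have hω' : ω' = T (t⁻¹ • ω) := by simp [hω, ht]
  fin_cases i
  · intro x
    obtain ⟨x, rfl⟩ := T.surjective x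
    rw [hδ, hi x, mul_zero]
  · change ω' = 0
    rw [hω', h0, show ω = 0 from hi, smul_zero]
  · intro x
    obtain ⟨x, rfl⟩ := T.surjective x
    rw [hω', ← hm, h0, map_smul, hi x, smul_zero]
  · obtain ⟨x, y, hxy⟩ := hi
    refine ⟨T (t⁻¹ • x), T y, ?_⟩
    rw [← hm, hω', ← hxy, map_smul, LinearMap.smul_apply]
  · intro x y
    obtain ⟨x, rfl⟩ := T.surjective x
    obtain ⟨y, rfl⟩ := T.surjective y
    rw [← hm, hδ, hi x y, mul_zero]
  · intro x hx
    obtain ⟨x, rfl⟩ := T.surjective x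
    rw [hδ, hi x, mul_zero]
    intro y
    have := hx (T y)
    rwa [← hm, h0] at this
  · change evenMul r' ω' ω' = 0
    rw [hω', ← hm, h0, map_smul, map_smul, LinearMap.smul_apply, show evenMul r ω ω = 0 from hi,
      smul_zero, smul_zero]
  · intro x hx
    obtain ⟨x, rfl⟩ := T.surjective x
    rw [hδ] at hx
    rw [← hm, h0]
    exact hi x ((mul_eq_zero.1 hx).resolve_left hs)

theorem Equivalent.symm (h : Equivalent r δ ω r' δ' ω') : Equivalent r' δ' ω' r δ ω :=
  equivalent_of_iso (iso_of_equivalent h).symm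

/-- The values of `invariant` in coordinates. -/
def coordInvariant (r : EvenType) (δ ω : Fin 3 → ℂ) : Fin 8 → Prop :=
  ![δ 0 = 0 ∧ δ 1 = 0 ∧ δ 2 = 0,
    ω 0 = 0 ∧ ω 1 = 0 ∧ ω 2 = 0,
    match r with
      | .J31 => True
      | .J32 => ω 0 = 0
      | .J33 | .J34 => ω 0 = 0 ∧ ω 1 = 0,
    match r with
      | .J31 => ω 0 = 0 ∧ ω 1 = 0 ∧ ω 2 = 0
      | .J32 => ω 0 = 0 ∧ ω 2 = 0
      | .J33 => ω 0 = 0 ∧ ω 1 = 0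
      | .J34 => ω 0 = 0,
    match r with
      | .J31 => True
      | .J32 => δ 1 = 0
      | .J33 => δ 2 = 0
      | .J34 => δ 1 = 0 ∧ δ 2 = 0,
    match r with
      | .J31 => δ 0 = 0 ∧ δ 1 = 0 ∧ δ 2 = 0
      | .J32 => δ 1 = 0 ∧ δ 2 = 0
      | .J33 | .J34 => δ 2 = 0,
    match r with
      | .J31 => True
      | .J33 => ω 0 * ω 1 = 0
      | .J32 | .J34 => ω 0 = 0,
    match r with
      | .J31 => True
      | .J33 => δ 2 = 0 ∧ δ 0 * δ 1 = 0 ∧ ¬ (δ 0 = 0 ∧ δ 1 = 0)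
      | .J32 | .J34 => δ 0 ≠ 0 ∧ δ 1 = 0 ∧ δ 2 = 0]

theorem form_eq_zero_iff : (∀ x, form δ x = 0) ↔ δ 0 = 0 ∧ δ 1 = 0 ∧ δ 2 = 0 := by
  constructor
  · intro h
    have h0 := h ![1, 0, 0]
    have h1 := h ![0, 1, 0]
    have h2 := h ![0, 0, 1]
    simp [form_apply] at h0 h1 h2
    exact ⟨h0, h1, h2⟩
  · rintro ⟨h0, h1, h2⟩ x
    simp [form_apply, *]

theorem annihilates_iff : (∀ x, evenMul r x ω = 0) ↔
    match r with
      | .J31 => True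
      | .J32 => ω 0 = 0
      | .J33 | .J34 => ω 0 = 0 ∧ ω 1 = 0 := by
  constructor
  · intro h
    have h0 := (eq_zero_iff_coord _).1 (h ![1, 0, 0])
    have h1 := (eq_zero_iff_coord _).1 (h ![0, 1, 0])
    cases r <;> simp_all [evenMul]
  · intro h x
    cases r <;> simp_all [evenMul]

theorem exists_mul_eq_iff : (∃ x y, evenMul r x y = ω) ↔
    match r with
      | .J31 => ω 0 = 0 ∧ ω 1 = 0 ∧ ω 2 = 0
      | .J32 => ω 0 = 0 ∧ ω 2 = 0
      | .J33 => ω 0 = 0 ∧ ω 1 = 0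
      | .J34 => ω 0 = 0 := by
  constructor
  · rintro ⟨x, y, rfl⟩
    cases r <;> simp [evenMul]
  · intro h
    cases r
    · refine ⟨0, 0, ?_⟩
      ext t; fin_cases t <;> simp_all
    · refine ⟨![1, 0, 0], ![ω 1, 0, 0], ?_⟩
      ext t; fin_cases t <;> simp_all [evenMul]
    · refine ⟨![1, 0, 0], ![0, ω 2, 0], ?_⟩
      ext t; fin_cases t <;> simp_all [evenMul]
    · refine ⟨![1, 0, 0], ![ω 1, ω 2, 0], ?_⟩
      ext t; fin_cases t <;> simp_all [evenMul]

theorem form_mul_eq_zero_iff : (∀ x y, form δ (evenMul r x y) = 0) ↔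
    match r with
      | .J31 => True
      | .J32 => δ 1 = 0
      | .J33 => δ 2 = 0
      | .J34 => δ 1 = 0 ∧ δ 2 = 0 := by
  constructor
  · intro h
    have h0 := h ![1, 0, 0] ![1, 0, 0]
    have h1 := h ![1, 0, 0] ![0, 1, 0]
    cases r <;> simp_all [evenMul, form_apply]
  · intro h x y
    cases r <;> simp_all [evenMul, form_apply]

theorem form_annihilator_eq_zero_iff :
    (∀ x, (∀ y, evenMul r y x = 0) → form δ x = 0) ↔
    match r with
      | .J31 => δ 0 = 0 ∧ δ 1 = 0 ∧ δ 2 = 0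
      | .J32 => δ 1 = 0 ∧ δ 2 = 0
      | .J33 | .J34 => δ 2 = 0 := by
  simp only [annihilates_iff]
  constructor
  · intro h
    have h0 := h ![1, 0, 0]
    have h1 := h ![0, 1, 0]
    have h2 := h ![0, 0, 1]
    cases r <;> simp_all [form_apply]
  · intro h x hx
    cases r <;> simp_all [form_apply]

/-- The square-zero elements form the plane `x₀ = 0` for `J32` and `J34`, and the two planes `x₀x₁ =
0` for `J33`. The kernel of `δ` lies in such a set only if it is one of these planes. -/
theorem mul_self_of_form_iff : (∀ x, form δ x = 0 → evenMul r x x = 0) ↔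
    match r with
      | .J31 => True
      | .J33 => δ 2 = 0 ∧ δ 0 * δ 1 = 0 ∧ ¬ (δ 0 = 0 ∧ δ 1 = 0)
      | .J32 | .J34 => δ 0 ≠ 0 ∧ δ 1 = 0 ∧ δ 2 = 0 := by
  have key : (∀ x : Fin 3 → ℂ, form δ x = 0 → x 0 = 0) ↔ δ 0 ≠ 0 ∧ δ 1 = 0 ∧ δ 2 = 0 := by
    constructor
    · intro h
      refine ⟨fun h0 => ?_, ?_, ?_⟩
      · simpa [form_apply, h0] using h ![1, 0, 0]
      · by_contra h1
        simpa [form_apply, mul_div_cancel₀ _ h1] using h ![1, -δ 0 / δ 1, 0]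
      · by_contra h1
        simpa [form_apply, mul_div_cancel₀ _ h1] using h ![1, 0, -δ 0 / δ 2]
    · rintro ⟨h0, h1, h2⟩ x
      simp [form_apply, h0, h1, h2]
  have key' : (∀ x : Fin 3 → ℂ, form δ x = 0 → x 0 * x 1 = 0) ↔
      δ 2 = 0 ∧ δ 0 * δ 1 = 0 ∧ ¬ (δ 0 = 0 ∧ δ 1 = 0) := by
    constructor
    · intro h
      have h2 : δ 2 = 0 := by
        by_contra h1
        -- A vector of the kernel of `δ` with `x₀x₁ = 1`.
        have := h ![1, 1, -(δ 0 + δ 1) / δ 2]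
        simp [form_apply] at this
        field_simp at this
        simp at this
      refine ⟨h2, ?_, ?_⟩
      · have := h ![δ 1, -δ 0, 0]
        simp [form_apply, mul_comm] at this
        simpa [or_comm] using this
      · rintro ⟨h0, h1⟩
        simpa [form_apply, h0, h1, h2] using h ![1, 1, 0]
    · rintro ⟨h2, h01, h⟩ x hx
      rw [form_apply, h2] at hx
      rcases mul_eq_zero.1 h01 with h0 | h1
      · simp_all
      · simp_all
  cases r
  · simp [evenMul]
  · rw [← key]
    simp [evenMul]
  · rw [← key']
    have : ∀ x : Fin 3 → ℂ, x 0 * x 1 + x 1 * x 0 = 0 ↔ x 0 * x 1 = 0 := fun x => by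
      rw [mul_comm (x 1), ← two_mul]; simp
    simp [evenMul, this]
  · rw [← key]
    refine forall₂_congr fun x _ => ?_
    simp only [evenMul, eq_zero_iff_coord]
    constructor
    · intro h; simpa using h.2.1
    · intro h; simp [h]

theorem invariant_iff (r : EvenType) (δ ω : Fin 3 → ℂ) (i : Fin 8) :
    invariant r δ ω i ↔ coordInvariant r δ ω i := by
  fin_cases i
  · exact form_eq_zero_iff
  · exact eq_zero_iff_coord ω
  · exact annihilates_iff
  · exact exists_mul_eq_iff
  · exact form_mul_eq_zero_iff
  · exact form_annihilator_eq_zero_iff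
  · cases r <;> simp [invariant, coordInvariant, evenMul, eq_zero_iff_coord, mul_comm, ← two_mul] <;>
      tauto
  · exact mul_self_of_form_iff

/-- The indices of the entries of `table` that have the respective property `invariant`. -/
def invariantSet : Fin 8 → List (Fin 29) :=
  ![[0, 1, 4, 5, 6, 7, 14, 15, 16, 17, 23, 24, 25],
    [0, 2, 4, 8, 9, 11, 14, 18, 19, 21, 23, 26, 27],
    [0, 1, 2, 3, 4, 6, 7, 8, 9, 10, 11, 12, 13, 14, 16, 18, 19, 20, 21, 22, 23, 25, 26, 27, 28],
    [0, 2, 4, 6, 8, 9, 10, 11, 12, 14, 16, 18, 19, 20, 21, 22, 23, 24, 25, 26, 27, 28],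
    [0, 1, 2, 3, 4, 5, 6, 7, 9, 10, 11, 12, 13, 14, 15, 16, 17, 19, 20, 21, 22, 23, 24, 25, 27, 28],
    [0, 1, 4, 5, 6, 7, 11, 12, 13, 14, 15, 16, 17, 19, 20, 21, 22, 23, 24, 25, 26, 27, 28],
    [0, 1, 2, 3, 4, 6, 7, 8, 9, 10, 11, 12, 13, 14, 15, 16, 18, 19, 20, 21, 22, 23, 24, 25, 26, 27, 28],
    [0, 1, 2, 3, 11, 12, 13, 19, 20, 27, 28]]

set_option maxHeartbeats 1000000 in
theorem coordInvariant_table (n : Fin 29) (i : Fin 8) :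
    coordInvariant (evenType n) (tableForm n) (tableVec n) i ↔ n ∈ invariantSet i := by
  revert i
  fin_cases n <;> simp [evenType, tableForm, tableVec] <;> intro i <;> fin_cases i <;>
    simp [coordInvariant, invariantSet]

/-- A numbering of the even types. -/
def EvenType.index : EvenType → Fin 4
  | .J31 => 0
  | .J32 => 1
  | .J33 => 2
  | .J34 => 3

/-- A finite check that the even type and the eight properties separate all entries. -/
theorem eq_of_invariantSet : ∀ m n : Fin 29, (evenType m).index = (evenType n).index →
    (∀ i, m ∈ invariantSet i ↔ n ∈ invariantSet i) → m = n := by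
  decide

theorem eq_of_table_iso (m n : Fin 29) (h : (table m).Iso (table n)) : m = n := by
  rw [table_eq, table_eq] at h
  have h := equivalent_of_iso h
  apply eq_of_invariantSet
  · obtain ⟨T, -, -, -, -, hT, -⟩ := h
    rw [evenType_eq_of_equiv T hT]
  · intro i
    rw [← coordInvariant_table, ← coordInvariant_table, ← invariant_iff, ← invariant_iff]
    exact ⟨invariant_of_equivalent h i, invariant_of_equivalent h.symm i⟩

theorem table_evenPartIso_iff (n : Fin 29) (r : EvenType) :
    (table n).EvenPartIso (evenMul r) ↔ r = evenType n := by
  rw [table_eq]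
  have hmem : ∀ x, x ∈ (model (evenType n) (tableForm n) (tableVec n)).part 0 ↔ x.2 = 0 := by
    intro x
    rw [mem_model_zero]
    exact ⟨by rintro ⟨a, rfl⟩; rfl, fun h => ⟨x.1, Prod.ext rfl h⟩⟩
  let T : (model (evenType n) (tableForm n) (tableVec n)).part 0 ≃ₗ[ℂ] (Fin 3 → ℂ) :=
    { toFun := fun x => x.1.1
      invFun := fun a => ⟨(a, 0), (hmem _).2 rfl⟩
      map_add' := fun _ _ => rfl
      map_smul' := fun _ _ => rfl
      left_inv := fun x => Subtype.ext (Prod.ext rfl ((hmem _).1 x.2).symm)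
      right_inv := fun _ => rfl }
  have hT : ∀ x y z : (model (evenType n) (tableForm n) (tableVec n)).part 0,
      (z : (Fin 3 → ℂ) × (Fin 2 → ℂ)) = (model (evenType n) (tableForm n) (tableVec n)).mul x y →
      T z = evenMul (evenType n) (T x) (T y) := by
    intro x y z h
    have hx := (hmem _).1 x.2
    have h1 : T z = (z : (Fin 3 → ℂ) × (Fin 2 → ℂ)).1 := rfl
    rw [h1, h, model_mul, hx]
    simp [T]
  constructor
  · rintro ⟨S, hS⟩
    symm
    refine evenType_eq_of_equiv (T.symm.trans S) fun x y => ?_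
    have h2 := hS (T.symm x) (T.symm y) (T.symm (evenMul (evenType n) x y))
    refine h2 ?_
    have hm := model_mul_even_even (r := evenType n) (δ := tableForm n) (ω := tableVec n) x y
    exact hm.symm
  · rintro rfl
    exact ⟨T, hT⟩

end JordanSuper

/-! ### Reduction of an arbitrary algebra to a model -/

namespace JordanSuper

open Superalgebra

namespace Superalgebra

variable {J : Type*} [AddCommGroup J] [Module ℂ J] {A : Superalgebra J}

/-- An invariant subspace `V` of positive dimension contains an invariant hyperplane `H` with
`J₀ V ⊆ H`. -/
theorem IsNilpotent.exists_hyperplane (hA : A.IsNilpotent) {n : ℕ} {V : Submodule ℂ J}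
    (hn : Module.finrank ℂ V = n + 1) (hV : ∀ x ∈ A.part 0, ∀ v ∈ V, A.mul x v ∈ V) :
    ∃ (v : J) (H : Submodule ℂ J), v ∈ V ∧ H ≤ V ∧ Module.finrank ℂ H = n ∧
      (∀ x ∈ A.part 0, ∀ y ∈ V, A.mul x y ∈ H) ∧ ∀ x ∈ V, ∃ c : ℂ, x - c • v ∈ H := by
  have : Module.Finite ℂ V := Module.finite_of_finrank_eq_succ hn
  set W := Submodule.map₂ A.mul (A.part 0) V with hW
  have hWV : W ≤ V := Submodule.map₂_le.2 hV
  have hne : W ≠ V := by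
    intro h
    have : V = ⊥ := hA.eq_bot_of_le_right (h.ge.trans (Submodule.map₂_le_map₂_left le_top))
    rw [this, finrank_bot] at hn
    omega
  set W' := W.comap V.subtype with hW'
  have hlt : W' < ⊤ := by
    rw [lt_top_iff_ne_top]
    intro h
    rw [hW', Submodule.comap_subtype_eq_top] at h
    exact hne (le_antisymm hWV h)
  -- The hyperplane is the kernel of a functional that vanishes on `J₀V`, and `v` is a vector where
  -- it equals 1.
  obtain ⟨φ, hφ, hφW⟩ := Submodule.exists_le_ker_of_lt_top W' hlt
  obtain ⟨u, hu⟩ := LinearMap.surjective hφ 1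
  refine ⟨u, (LinearMap.ker φ).map V.subtype, u.2, Submodule.map_subtype_le _ _, ?_, ?_, ?_⟩
  · rw [Submodule.finrank_map_subtype_eq]
    have h1 := LinearMap.finrank_range_add_finrank_ker φ
    rw [LinearMap.range_eq_top.2 (LinearMap.surjective hφ), finrank_top, Module.finrank_self,
      hn] at h1
    omega
  · intro x hx y hy
    have hm : A.mul x y ∈ W := Submodule.apply_mem_map₂ _ hx hy
    exact ⟨⟨_, hWV hm⟩, hφW (by simpa [hW'] using hm), rfl⟩
  · intro x hx
    refine ⟨φ ⟨x, hx⟩, ⟨⟨x, hx⟩ - φ ⟨x, hx⟩ • u, ?_, rfl⟩⟩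
    simp [hu]

theorem sgn_mul_zero (i : ZMod 2) : sgn (i * 0) = 1 := by rw [mul_zero, sgn_zero]

theorem IsJordan.mul_even_comm (hJ : A.IsJordan) {x y : J} (hx : x ∈ A.part 0)
    {i : ZMod 2} (hy : y ∈ A.part i) : A.mul y x = A.mul x y := by
  rw [hJ.supercomm i 0 y x hy hx, sgn_mul_zero, one_smul]

theorem IsJordan.mul_odd_anticomm (hJ : A.IsJordan) {x y : J} (hx : x ∈ A.part 1)
    (hy : y ∈ A.part 1) : A.mul y x = -A.mul x y := by
  rw [hJ.supercomm 1 1 y x hy hx, mul_one, sgn_one, neg_smul, one_smul]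

theorem IsJordan.mul_odd_self (hJ : A.IsJordan) {x : J} (hx : x ∈ A.part 1) :
    A.mul x x = 0 := by
  have h := hJ.mul_odd_anticomm hx hx
  have h2 : (2 : ℂ) • A.mul x x = 0 := by
    rw [two_smul]
    nth_rewrite 1 [h]
    exact neg_add_cancel _
  exact (smul_eq_zero.1 h2).resolve_left two_ne_zero

/-- A triple of even elements that spans the even part and multiplies as the basis of `r`. -/
structure EvenFrame (A : Superalgebra J) (r : EvenType) (e : Fin 3 → J) : Prop where
  mem : ∀ i, e i ∈ A.part 0
  span : ∀ x ∈ A.part 0, ∃ c : Fin 3 → ℂ, x = c 0 • e 0 + c 1 • e 1 + c 2 • e 2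
  mul : ∀ i j, A.mul (e i) (e j) =
    evenMul r (Pi.single i 1) (Pi.single j 1) 0 • e 0
      + evenMul r (Pi.single i 1) (Pi.single j 1) 1 • e 1
      + evenMul r (Pi.single i 1) (Pi.single j 1) 2 • e 2

/-- A spanning triple of even elements with triangular multiplication. -/
theorem exists_triangular (hJ : A.IsJordan) (hA : A.IsNilpotent)
    (h3 : Module.finrank ℂ (A.part 0) = 3) :
    ∃ (e₁ e₂ e₃ : J) (a b c d : ℂ), e₁ ∈ A.part 0 ∧ e₂ ∈ A.part 0 ∧ e₃ ∈ A.part 0 ∧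
      (∀ x ∈ A.part 0, ∃ p q r : ℂ, x = p • e₁ + q • e₂ + r • e₃) ∧
      A.mul e₁ e₁ = a • e₂ + b • e₃ ∧ A.mul e₁ e₂ = c • e₃ ∧ A.mul e₂ e₁ = c • e₃ ∧
      A.mul e₂ e₂ = d • e₃ ∧ A.mul e₁ e₃ = 0 ∧ A.mul e₂ e₃ = 0 ∧ A.mul e₃ e₁ = 0 ∧
      A.mul e₃ e₂ = 0 ∧ A.mul e₃ e₃ = 0 := by
  have h00 : ∀ x ∈ A.part 0, ∀ y ∈ A.part 0, A.mul x y ∈ A.part 0 := fun x hx y hy => by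
    simpa using A.mul_mem 0 0 x y hx hy
  -- A flag `J₀ ⊃ H ⊃ K ⊃ L = 0` in which multiplication by `J₀` sends each term into the next.
  obtain ⟨e₁, H, he₁, hH, hn, hm, hs⟩ := hA.exists_hyperplane h3 h00
  obtain ⟨e₂, K, he₂, hK, hn', hm', hs'⟩ := hA.exists_hyperplane hn
    fun x hx v hv => hm x hx v (hH hv)
  obtain ⟨e₃, L, he₃, hL, hn'', hm'', hs''⟩ := hA.exists_hyperplane hn'
    fun x hx v hv => hm' x hx v (hK hv)
  have hKf : Module.Finite ℂ K := Module.finite_of_finrank_eq_succ hn'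
  have hLf : Module.Finite ℂ L := Module.Finite.of_injective _ (Submodule.inclusion_injective hL)
  have hL0 : L = ⊥ := Submodule.finrank_eq_zero.1 hn''
  have hsK : ∀ x ∈ K, ∃ c : ℂ, x = c • e₃ := fun x hx => by
    obtain ⟨c, hc⟩ := hs'' x hx
    rw [hL0, Submodule.mem_bot, sub_eq_zero] at hc
    exact ⟨c, hc⟩
  have hsH : ∀ x ∈ H, ∃ c d : ℂ, x = c • e₂ + d • e₃ := fun x hx => by
    obtain ⟨c, hc⟩ := hs' x hx
    obtain ⟨d, hd⟩ := hsK _ hc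
    exact ⟨c, d, by rw [← hd]; abel⟩
  have hsE : ∀ x ∈ A.part 0, ∃ p q r : ℂ, x = p • e₁ + q • e₂ + r • e₃ := fun x hx => by
    obtain ⟨c, hc⟩ := hs x hx
    obtain ⟨d, f, hd⟩ := hsH _ hc
    exact ⟨c, d, f, by rw [add_assoc, ← hd]; abel⟩
  have he₂' := hH he₂
  have he₃' := hH (hK he₃)
  obtain ⟨a, b, hab⟩ := hsH _ (hm e₁ he₁ e₁ he₁)
  obtain ⟨c, hc⟩ := hsK _ (hm' e₁ he₁ e₂ he₂)
  obtain ⟨d, hd⟩ := hsK _ (hm' e₂ he₂' e₂ he₂)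
  have h0 : ∀ x ∈ A.part 0, A.mul x e₃ = 0 := fun x hx => by
    have := hm'' x hx e₃ he₃
    rwa [hL0, Submodule.mem_bot] at this
  exact ⟨e₁, e₂, e₃, a, b, c, d, he₁, he₂', he₃', hsE, hab, hc,
    by rw [hJ.mul_even_comm he₁ he₂', hc], hd, h0 _ he₁, h0 _ he₂',
    by rw [hJ.mul_even_comm he₁ he₃', h0 _ he₁], by rw [hJ.mul_even_comm he₂' he₃', h0 _ he₂'],
    h0 _ he₃'⟩

/-- The rows of an invertible matrix form an even frame if their products are as required. -/
theorem EvenFrame.of_matrix {e₁ e₂ e₃ : J} {a b c d : ℂ} (m₁ : e₁ ∈ A.part 0)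
    (m₂ : e₂ ∈ A.part 0) (m₃ : e₃ ∈ A.part 0)
    (hs : ∀ x ∈ A.part 0, ∃ p q r : ℂ, x = p • e₁ + q • e₂ + r • e₃)
    (hm : ∀ p q r p' q' r' : ℂ, A.mul (p • e₁ + q • e₂ + r • e₃) (p' • e₁ + q' • e₂ + r' • e₃) =
      (a * (p * p')) • e₂ + (b * (p * p') + c * (p * q' + q * p') + d * (q * q')) • e₃)
    (r : EvenType) (M N : Matrix (Fin 3) (Fin 3) ℂ) (hN : N * M = 1)
    (h₁ : ∀ i j, ∑ l, evenMul r (Pi.single i 1) (Pi.single j 1) l * M l 0 = 0)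
    (h₂ : ∀ i j, ∑ l, evenMul r (Pi.single i 1) (Pi.single j 1) l * M l 1 =
      a * (M i 0 * M j 0))
    (h₃ : ∀ i j, ∑ l, evenMul r (Pi.single i 1) (Pi.single j 1) l * M l 2 =
      b * (M i 0 * M j 0) + c * (M i 0 * M j 1 + M i 1 * M j 0) + d * (M i 1 * M j 1)) :
    ∃ r e, A.EvenFrame r e := by
  refine ⟨r, fun i => M i 0 • e₁ + M i 1 • e₂ + M i 2 • e₃, fun i => ?_, fun x hx => ?_,
    fun i j => ?_⟩
  · exact add_mem (add_mem (Submodule.smul_mem _ _ m₁) (Submodule.smul_mem _ _ m₂))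
      (Submodule.smul_mem _ _ m₃)
  · obtain ⟨p, q, s, rfl⟩ := hs x hx
    have key : ∀ k, p * (N * M) 0 k + q * (N * M) 1 k + s * (N * M) 2 k =
        ∑ l, (p * N 0 l + q * N 1 l + s * N 2 l) * M l k := fun k => by
      simp only [Matrix.mul_apply, Fin.sum_univ_three]; ring
    have k0 := key 0
    have k1 := key 1
    have k2 := key 2
    simp [hN, Fin.sum_univ_three] at k0 k1 k2
    refine ⟨fun l => p * N 0 l + q * N 1 l + s * N 2 l, ?_⟩
    linear_combination (norm := module) k0 • e₁ + k1 • e₂ + k2 • e₃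
  · have k1 := h₁ i j
    have k2 := h₂ i j
    have k3 := h₃ i j
    rw [Fin.sum_univ_three] at k1 k2 k3
    rw [hm, ← k2, ← k3]
    linear_combination (norm := module) -k1 • e₁

/-- If `a = 0`, the product is a symmetric bilinear form on the span of `e₁, e₂` with matrix `(b, c;
c, d)` and values in `ℂe₃`; ranks 0, 1, 2 give `J31`, `J32`, `J33`. If `a ≠ 0`, the Jordan identity
kills `e₂²`, and `c` decides between `J32` and `J34`. -/
theorem exists_evenFrame (hJ : A.IsJordan) (hA : A.IsNilpotent)
    (h3 : Module.finrank ℂ (A.part 0) = 3) : ∃ r e, A.EvenFrame r e := by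
  obtain ⟨e₁, e₂, e₃, a, b, c, d, m₁, m₂, m₃, hs, h11, h12, h21, h22, h13, h23, h31, h32, h33⟩ :=
    exists_triangular hJ hA h3
  by_cases ha : a = 0
  · subst ha
    have hm : ∀ p q r p' q' r' : ℂ,
        A.mul (p • e₁ + q • e₂ + r • e₃) (p' • e₁ + q' • e₂ + r' • e₃) =
        ((0 : ℂ) * (p * p')) • e₂ +
          (b * (p * p') + c * (p * q' + q * p') + d * (q * q')) • e₃ := by
      intro p q r p' q' r'
      simp only [map_add, map_smul, LinearMap.add_apply, LinearMap.smul_apply, h11, h12, h21, h22,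
        h13, h23, h31, h32, h33]
      module
    have build := EvenFrame.of_matrix m₁ m₂ m₃ hs hm
    by_cases hD : c ^ 2 = b * d
    · by_cases hb : b = 0
      · subst hb
        have hc : c = 0 := by simpa using hD
        subst hc
        by_cases hd : d = 0
        · subst hd
          apply build .J31 1 1 (one_mul 1) <;> intro i j <;> simp [evenMul, Fin.sum_univ_three]
        · apply build .J32 !![0, 1, 0; 0, 0, d; 1, 0, 0] !![0, 0, 1; 1, 0, 0; 0, d⁻¹, 0]
          · ext i j
            fin_cases i <;> fin_cases j <;> simp [Matrix.mul_apply, Fin.sum_univ_three, hd]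
          all_goals intro i j; fin_cases i <;> fin_cases j <;> simp [evenMul, Fin.sum_univ_three]
      -- The vector `-(c/b)e₁ + e₂` spans the radical of the form and becomes the third basis
      -- vector.
      · apply build .J32 !![1, 0, 0; 0, 0, b; -c / b, 1, 0] !![1, 0, 0; c / b, 0, 1; 0, b⁻¹, 0]
        · ext i j
          fin_cases i <;> fin_cases j <;> simp [Matrix.mul_apply, Fin.sum_univ_three, hb] <;>
            field_simp <;> ring
        all_goals
          intro i j
          fin_cases i <;> fin_cases j <;> simp [evenMul, Fin.sum_univ_three] <;> field_simp <;>
            first | ring1 | linear_combination hD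
    · by_cases hb : b = 0
      · subst hb
        have hc : c ≠ 0 := by rintro rfl; simp at hD
        apply build .J33 !![1, 0, 0; -d / (2 * c), 1, 0; 0, 0, c]
          !![1, 0, 0; d / (2 * c), 1, 0; 0, 0, c⁻¹]
        · ext i j
          fin_cases i <;> fin_cases j <;> simp [Matrix.mul_apply, Fin.sum_univ_three, hc] <;>
            field_simp <;> ring
        all_goals
          intro i j
          fin_cases i <;> fin_cases j <;> simp [evenMul, Fin.sum_univ_three] <;> field_simp <;>
            ring
      -- A nondegenerate form has two isotropic lines, spanned by `((-c ± s)/b)e₁ + e₂` with `s² =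
      -- c² - bd`; the product of these vectors is `(-2s²/b)e₃`.
      · obtain ⟨s, hs'⟩ := IsAlgClosed.exists_pow_nat_eq (c ^ 2 - b * d) (n := 2) (by norm_num)
        have hs0 : s ≠ 0 := by
          rintro rfl
          exact hD (by linear_combination -hs')
        apply build .J33 !![(-c + s) / b, 1, 0; (-c - s) / b, 1, 0; 0, 0, -2 * s ^ 2 / b]
          !![b / (2 * s), -b / (2 * s), 0; (c + s) / (2 * s), (s - c) / (2 * s), 0;
            0, 0, -b / (2 * s ^ 2)]
        · ext i j
          fin_cases i <;> fin_cases j <;> simp [Matrix.mul_apply, Fin.sum_univ_three] <;>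
            field_simp <;> ring
        all_goals
          intro i j
          fin_cases i <;> fin_cases j <;> simp [evenMul, Fin.sum_univ_three] <;> field_simp <;>
            first | ring1 | linear_combination hs' | linear_combination -hs'
  · have hd : d • e₃ = 0 := by
      -- With all arguments `e₁` the identity reads `3(e₁²)² = 3e₁(e₁e₁²)`; the left side is `3a²d
      -- e₃`, the right side vanishes.
      have h := hJ.superidentity 0 0 0 0 e₁ e₁ e₁ e₁ m₁ m₁ m₁ m₁
      simp only [mul_zero, add_zero, sgn_zero, one_smul, h11, map_add, map_smul,
        LinearMap.add_apply, LinearMap.smul_apply, h12, h13, h22, h23, h32, h33, smul_zero] at h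
      have h' : (3 * a ^ 2) • d • e₃ = 0 := by
        rw [← h]
        module
      exact (smul_eq_zero.1 h').resolve_left (by simp [ha])
    rw [hd] at h22
    have hm : ∀ p q r p' q' r' : ℂ,
        A.mul (p • e₁ + q • e₂ + r • e₃) (p' • e₁ + q' • e₂ + r' • e₃) =
        (a * (p * p')) • e₂ +
          (b * (p * p') + c * (p * q' + q * p') + 0 * (q * q')) • e₃ := by
      intro p q r p' q' r'
      simp only [map_add, map_smul, LinearMap.add_apply, LinearMap.smul_apply, h11, h12, h21, h22,
        h13, h23, h31, h32, h33]
      module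
    have build := EvenFrame.of_matrix m₁ m₂ m₃ hs hm
    by_cases hc : c = 0
    · subst hc
      apply build .J32 !![1, 0, 0; 0, a, b; 0, 0, 1] !![1, 0, 0; 0, a⁻¹, -b / a; 0, 0, 1]
      · ext i j
        fin_cases i <;> fin_cases j <;> simp [Matrix.mul_apply, Fin.sum_univ_three, ha] <;>
          field_simp <;> ring
      all_goals intro i j; fin_cases i <;> fin_cases j <;> simp [evenMul, Fin.sum_univ_three]
    · apply build .J34 !![1, 0, 0; 0, a, b; 0, 0, a * c]
        !![1, 0, 0; 0, a⁻¹, -b / (a ^ 2 * c); 0, 0, (a * c)⁻¹]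
      · ext i j
        fin_cases i <;> fin_cases j <;> simp [Matrix.mul_apply, Fin.sum_univ_three, ha] <;>
          field_simp <;> ring
      all_goals
        intro i j; fin_cases i <;> fin_cases j <;> simp [evenMul, Fin.sum_univ_three] <;> ring

/-- The odd part of a nilpotent Jordan superalgebra of type `(m, 2)`. -/
theorem exists_oddFrame (hA : A.IsNilpotent) (h2 : Module.finrank ℂ (A.part 1) = 2) :
    ∃ f₁ ∈ A.part 1, ∃ f₂ ∈ A.part 1, (∀ x ∈ A.part 1, ∃ p q : ℂ, x = p • f₁ + q • f₂) ∧
      ∀ x ∈ A.part 0, A.mul x f₁ = 0 ∧ ∃ p : ℂ, A.mul x f₂ = p • f₁ := by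
  have h01 : ∀ x ∈ A.part 0, ∀ y ∈ A.part 1, A.mul x y ∈ A.part 1 := fun x hx y hy => by
    simpa using A.mul_mem 0 1 x y hx hy
  obtain ⟨f₂, H, hf₂, hH, hn, hm, hs⟩ := hA.exists_hyperplane h2 h01
  obtain ⟨f₁, K, hf₁, hK, hn', hm', hs'⟩ := hA.exists_hyperplane hn
    fun x hx v hv => hm x hx v (hH hv)
  have hHf : Module.Finite ℂ H := Module.finite_of_finrank_eq_succ hn
  have hKf : Module.Finite ℂ K := Module.Finite.of_injective _ (Submodule.inclusion_injective hK)
  have hK0 : K = ⊥ := Submodule.finrank_eq_zero.1 hn'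
  have hsH : ∀ x ∈ H, ∃ c : ℂ, x = c • f₁ := fun x hx => by
    obtain ⟨c, hc⟩ := hs' x hx
    rw [hK0, Submodule.mem_bot, sub_eq_zero] at hc
    exact ⟨c, hc⟩
  refine ⟨f₁, hH hf₁, f₂, hf₂, fun x hx => ?_, fun x hx => ⟨?_, hsH _ (hm x hx f₂ hf₂)⟩⟩
  · obtain ⟨c, hc⟩ := hs x hx
    obtain ⟨d, hd⟩ := hsH _ hc
    exact ⟨d, c, by rw [← hd]; abel⟩
  · have := hm' x hx f₁ hf₁
    rwa [hK0, Submodule.mem_bot] at this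

theorem exists_iso_model (hJ : A.IsJordan) (hA : A.IsNilpotent) (hT : A.HasType 3 2) :
    ∃ r δ ω, A.Iso (model r δ ω) := by
  obtain ⟨hfin, h3, h2⟩ := hT
  obtain ⟨r, e, he, hes, hem⟩ := exists_evenFrame hJ hA h3
  obtain ⟨f₁, hf₁, f₂, hf₂, hfs, hf⟩ := exists_oddFrame hA h2
  choose δ hδ using fun i => (hf (e i) (he i)).2
  have hf0 := fun i => (hf (e i) (he i)).1
  have h11 : A.mul f₁ f₂ ∈ A.part 0 := A.mul_mem 1 1 f₁ f₂ hf₁ hf₂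
  obtain ⟨ω, hω⟩ := hes _ h11
  have hω' : A.mul f₂ f₁ = -(ω 0 • e 0 + ω 1 • e 1 + ω 2 • e 2) := by
    rw [hJ.mul_odd_anticomm hf₁ hf₂, hω]
  have hδ' := fun i => (hJ.mul_even_comm (he i) hf₂).trans (hδ i)
  have hf0' := fun i => (hJ.mul_even_comm (he i) hf₁).trans (hf0 i)
  have hs1 := hJ.mul_odd_self hf₁
  have hs2 := hJ.mul_odd_self hf₂
  let Ψ : ((Fin 3 → ℂ) × (Fin 2 → ℂ)) →ₗ[ℂ] J :=
    { toFun := fun x => (x.1 0 • e 0 + x.1 1 • e 1 + x.1 2 • e 2) + (x.2 0 • f₁ + x.2 1 • f₂)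
      map_add' := fun x y => by
        simp only [Prod.fst_add, Prod.snd_add, Pi.add_apply]; module
      map_smul' := fun c x => by
        simp only [Prod.smul_fst, Prod.smul_snd, Pi.smul_apply, smul_eq_mul, RingHom.id_apply]
        module }
  have hΨ : ∀ x, Ψ x =
    (x.1 0 • e 0 + x.1 1 • e 1 + x.1 2 • e 2) + (x.2 0 • f₁ + x.2 1 • f₂) := fun _ => rfl
  have hsurj : Function.Surjective Ψ := by
    intro x
    have hx : x ∈ A.part 0 ⊔ A.part 1 := by
      rw [A.isCompl.sup_eq_top]; exact Submodule.mem_top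
    obtain ⟨y, hy, z, hz, rfl⟩ := Submodule.mem_sup.1 hx
    obtain ⟨c, rfl⟩ := hes y hy
    obtain ⟨p, q, rfl⟩ := hfs z hz
    exact ⟨(c, ![p, q]), by simp [hΨ]⟩
  have hdim : Module.finrank ℂ ((Fin 3 → ℂ) × (Fin 2 → ℂ)) = Module.finrank ℂ J := by
    rw [← Submodule.finrank_add_eq_of_isCompl A.isCompl, h3, h2]
    simp
  -- The frames are only known to span; linear independence follows from the dimension count.
  have hinj : Function.Injective Ψ :=
    (LinearMap.injective_iff_surjective_of_finrank_eq_finrank hdim).2 hsurj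
  refine ⟨r, δ, ω, Iso.symm ⟨LinearEquiv.ofBijective Ψ ⟨hinj, hsurj⟩, fun x y => ?_, fun i => ?_⟩⟩
  · change Ψ _ = A.mul (Ψ x) (Ψ y)
    rw [model_mul, hΨ, hΨ, hΨ]
    simp only [map_add, map_smul, LinearMap.add_apply, LinearMap.smul_apply, hem, hω, hω', hδ, hδ',
      hf0, hf0', hs1, hs2]
    cases r <;> simp [evenMul, form_apply] <;> module
  · have h2 : ∀ i : ZMod 2, i = 0 ∨ i = 1 := by decide
    ext x
    rcases h2 i with rfl | rfl
    · constructor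
      · rintro ⟨y, hy, rfl⟩
        obtain ⟨a, rfl⟩ := (mem_model_zero _ _ _ _).1 hy
        change Ψ (a, 0) ∈ A.part 0
        simp only [hΨ, Pi.zero_apply, zero_smul, add_zero]
        exact add_mem (add_mem (Submodule.smul_mem _ _ (he 0)) (Submodule.smul_mem _ _ (he 1)))
          (Submodule.smul_mem _ _ (he 2))
      · intro hx
        obtain ⟨c, rfl⟩ := hes x hx
        refine ⟨(c, 0), (mem_model_zero _ _ _ _).2 ⟨c, rfl⟩, ?_⟩
        change Ψ (c, 0) = _
        simp [hΨ]
    · constructor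
      · rintro ⟨y, hy, rfl⟩
        obtain ⟨a, rfl⟩ := (mem_model_one _ _ _ _).1 hy
        change Ψ (0, a) ∈ A.part 1
        simp only [hΨ, Pi.zero_apply, zero_smul, add_zero, zero_add]
        exact add_mem (Submodule.smul_mem _ _ hf₁) (Submodule.smul_mem _ _ hf₂)
      · intro hx
        obtain ⟨p, q, rfl⟩ := hfs x hx
        refine ⟨(0, ![p, q]), (mem_model_one _ _ _ _).2 ⟨_, rfl⟩, ?_⟩
        change Ψ (0, ![p, q]) = _
        simp [hΨ]

end Superalgebra

end JordanSuper

/-! ### Admissible pairs and their orbits -/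

namespace JordanSuper

open Superalgebra

variable {r : EvenType} {δ ω δ' ω' : Fin 3 → ℂ}

/-- The conditions that the Jordan identity and nilpotency impose on `model r δ ω`. -/
theorem admissible_of_model (hJ : (model r δ ω).IsJordan)
    (hn : ∀ x y (c : ℂ), x = c • (model r δ ω).mul ((model r δ ω).mul x y) y → x = 0) :
    Admissible r δ ω := by
  have h0 : ∀ a, (a, 0) ∈ (model r δ ω).part 0 := fun a => (mem_model_zero _ _ _ _).2 ⟨a, rfl⟩
  have h1 : ∀ a, (0, a) ∈ (model r δ ω).part 1 := fun a => (mem_model_one _ _ _ _).2 ⟨a, rfl⟩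
  have h11 : (1 + 1 : ZMod 2) = 0 := by decide
  have hsq : ∀ y z, evenMul r ω (evenMul r y z) = 0 := fun y z => by
    -- For `f₁, y, z, f₂` every term except `(f₂f₁)(yz)` dies, because `J₀f₁ = 0` and `f₁² = 0`.
    have h := hJ.superidentity 1 0 0 1 (0, ![1, 0]) (y, 0) (z, 0) (0, ![0, 1]) (h1 _) (h0 _)
      (h0 _) (h1 _)
    have h := congrArg Prod.fst h
    simpa [model_mul_even_even, model_mul_even_odd, model_mul_odd_even, model_mul_odd_odd]
      using h
  refine ⟨fun x y z => ?_, hsq, fun y z => ?_, ?_, fun y z => ?_⟩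
  · have h := hJ.superidentity 0 0 1 0 (y, 0) (z, 0) (0, ![0, 1]) (x, 0) (h0 _) (h0 _)
      (h1 _) (h0 _)
    have h := congrFun (congrArg Prod.snd h) 0
    simpa [model_mul_even_even, model_mul_even_odd, model_mul_odd_even, model_mul_odd_odd,
      sgn_zero] using h
  · have h := hJ.superidentity 1 1 0 0 (0, ![1, 0]) (0, ![0, 1]) (y, 0) (z, 0) (h1 _) (h1 _)
      (h0 _) (h0 _)
    have h := congrArg Prod.fst h
    simpa [model_mul_even_even, model_mul_even_odd, model_mul_odd_even, model_mul_odd_odd,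
      sgn_zero, evenMul_comm r (evenMul r z y) ω, hsq] using h
  -- The one condition from nilpotency: otherwise `f₁` would be a multiple of `(f₁f₂)f₂`.
  · by_contra hne
    have h := hn (0, ![1, 0]) (0, ![0, 1]) (form δ ω)⁻¹ (by
      simp [model_mul_even_odd, model_mul_odd_odd, hne])
    simpa using congrFun (congrArg Prod.snd h) 0
  · have h := hJ.superidentity 1 0 0 1 (0, ![0, 1]) (y, 0) (z, 0) (0, ![0, 1]) (h1 _) (h0 _)
      (h0 _) (h1 _)
    have h := congrArg Prod.fst h
    simp [model_mul_even_even, model_mul_odd_even, model_mul_odd_odd, sgn_zero, sgn_one] at h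
    linear_combination (norm := module) h

/-- A change of the even basis: the columns of `M` are the images of the basis of the target. -/
theorem iso_of_matrix (M : Matrix (Fin 3) (Fin 3) ℂ) (s t : ℂ) (hM : M.det ≠ 0) (hs : s ≠ 0)
    (ht : t ≠ 0) (hm : ∀ x y, M.mulVec (evenMul r x y) = evenMul r (M.mulVec x) (M.mulVec y))
    (hδ : ∀ i, δ 0 * M 0 i + δ 1 * M 1 i + δ 2 * M 2 i = s * δ' i)
    (hω : M.mulVec ω' = t • ω) : (model r δ ω).Iso (model r δ' ω') := by
  apply Iso.symm
  apply iso_of_equivalent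
  have hu : IsUnit M := (Matrix.isUnit_iff_isUnit_det M).2 hM.isUnit
  have hinj : Function.Injective M.mulVecLin := Matrix.mulVec_injective_of_isUnit hu
  refine ⟨LinearEquiv.ofInjectiveEndo M.mulVecLin hinj, s, t, hs, ht, hm, fun x => ?_, hω⟩
  change form δ (M.mulVec x) = _
  simp only [form_apply, Matrix.mulVec, dotProduct, Fin.sum_univ_three]
  linear_combination x 0 * hδ 0 + x 1 * hδ 1 + x 2 * hδ 2

/-- All of `GL₃` acts, so for `δ(ω) = 0` only the vanishing of `δ` and of `ω` matters. A zero member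
of the pair is replaced by an auxiliary nonzero one so that `key` applies. -/
theorem exists_table_J31 (h : form δ ω = 0) : ∃ n, (model .J31 δ ω).Iso (table n) := by
  have hperp : ∀ v : Fin 3 → ℂ, ∃ w : Fin 3 → ℂ, w ≠ 0 ∧ v 0 * w 0 + v 1 * w 1 + v 2 * w 2 = 0 := by
    intro v
    by_cases h0 : v 0 = 0
    · exact ⟨![1, 0, 0], by simp, by simp [h0]⟩
    · exact ⟨![-v 1, v 0, 0], fun h => h0 (by simpa using congrFun h 1), by simp; ring⟩
  have hdual : ∀ v : Fin 3 → ℂ, v ≠ 0 → ∃ w : Fin 3 → ℂ,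
      v 0 * w 0 + v 1 * w 1 + v 2 * w 2 = 1 := by
    intro v hv
    obtain ⟨i, hi⟩ := Function.ne_iff.1 hv
    refine ⟨Pi.single i (v i)⁻¹, ?_⟩
    simp only [Pi.zero_apply] at hi
    fin_cases i <;> simp_all
  have key : ∀ d w : Fin 3 → ℂ, d ≠ 0 → w ≠ 0 → d 0 * w 0 + d 1 * w 1 + d 2 * w 2 = 0 →
      ∃ M : Matrix (Fin 3) (Fin 3) ℂ, M.det ≠ 0 ∧
        (∀ i, d 0 * M 0 i + d 1 * M 1 i + d 2 * M 2 i = (![1, 0, 0] : Fin 3 → ℂ) i) ∧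
        M.mulVec ![0, 1, 0] = w := by
    intro d w hd hw hdw
    obtain ⟨a, ha⟩ := hdual d hd
    obtain ⟨b, hb⟩ := hdual w hw
    -- The columns are `a`, `w`, `d × b` with `d·a = w·b = 1`; the determinant is `(a·d)(w·b) -
    -- (a·b)(w·d) = 1`.
    refine ⟨!![a 0, w 0, d 1 * b 2 - d 2 * b 1; a 1, w 1, d 2 * b 0 - d 0 * b 2;
      a 2, w 2, d 0 * b 1 - d 1 * b 0], ?_, fun i => ?_, ?_⟩
    · have : Matrix.det !![a 0, w 0, d 1 * b 2 - d 2 * b 1; a 1, w 1, d 2 * b 0 - d 0 * b 2;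
          a 2, w 2, d 0 * b 1 - d 1 * b 0] = 1 := by
        simp [Matrix.det_fin_three]
        linear_combination (w 0 * b 0 + w 1 * b 1 + w 2 * b 2) * ha + hb -
          (a 0 * b 0 + a 1 * b 1 + a 2 * b 2) * hdw
      rw [this]
      simp
    · fin_cases i
      · simpa using ha
      · simpa using hdw
      · simp; ring
    · ext i; fin_cases i <;> simp [Matrix.mulVec, dotProduct, Fin.sum_univ_three]
  have hm : ∀ (M : Matrix (Fin 3) (Fin 3) ℂ) x y,
      M.mulVec (evenMul .J31 x y) = evenMul .J31 (M.mulVec x) (M.mulVec y) := by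
    intro M x y
    ext i; simp [evenMul, Matrix.mulVec, dotProduct, Fin.sum_univ_three]
    fin_cases i <;> simp
  rw [form_apply] at h
  by_cases hδ : δ = 0
  · subst hδ
    by_cases hω : ω = 0
    · subst hω
      refine ⟨0, ?_⟩
      rw [table_eq]
      exact iso_of_matrix 1 1 1 (by simp) one_ne_zero one_ne_zero (hm 1) (by simp [tableForm])
        (by simp [tableVec])
    · obtain ⟨d, hd, hdw⟩ := hperp ω
      obtain ⟨M, h1, h2, h3⟩ := key d ω hd hω (by linear_combination hdw)
      refine ⟨1, ?_⟩
      rw [table_eq]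
      exact iso_of_matrix M 1 1 h1 one_ne_zero one_ne_zero (hm M) (by simp [tableForm])
        (by simpa [tableVec] using h3)
  · by_cases hω : ω = 0
    · subst hω
      obtain ⟨w, hw, hdw⟩ := hperp δ
      obtain ⟨M, h1, h2, h3⟩ := key δ w hδ hw hdw
      refine ⟨2, ?_⟩
      rw [table_eq]
      exact iso_of_matrix M 1 1 h1 one_ne_zero one_ne_zero (hm M) (by simpa [tableForm] using h2)
        (by simp [tableVec])
    · obtain ⟨M, h1, h2, h3⟩ := key δ ω hδ hω h
      refine ⟨3, ?_⟩
      rw [table_eq]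
      exact iso_of_matrix M 1 1 h1 one_ne_zero one_ne_zero (hm M) (by simpa [tableForm] using h2)
        (by simpa [tableVec] using h3)

/-- Automorphisms of `J32`. -/
theorem iso_J32 (a b c d f s t : ℂ) (ha : a ≠ 0) (hf : f ≠ 0) (hs : s ≠ 0) (ht : t ≠ 0)
    (h₀ : δ 0 * a + δ 1 * b + δ 2 * c = s * δ' 0) (h₁ : δ 1 * a ^ 2 = s * δ' 1)
    (h₂ : δ 1 * d + δ 2 * f = s * δ' 2) (k₀ : a * ω' 0 = t * ω 0)
    (k₁ : b * ω' 0 + a ^ 2 * ω' 1 + d * ω' 2 = t * ω 1) (k₂ : c * ω' 0 + f * ω' 2 = t * ω 2) :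
    (model .J32 δ ω).Iso (model .J32 δ' ω') := by
  refine iso_of_matrix !![a, 0, 0; b, a ^ 2, d; c, 0, f] s t ?_ hs ht (fun x y => ?_)
    (fun i => ?_) ?_
  · simp [Matrix.det_fin_three, ha, hf]
  · ext i; fin_cases i <;> simp [evenMul, Matrix.mulVec, dotProduct, Fin.sum_univ_three] <;> ring
  · fin_cases i <;> simp [h₀, h₁, h₂]
  · ext i; fin_cases i <;> simp [Matrix.mulVec, dotProduct, Fin.sum_univ_three, k₀, k₁, k₂]

/-- Automorphisms of `J33`. -/
theorem iso_J33 (a b p q s t : ℂ) (ha : a ≠ 0) (hb : b ≠ 0) (hs : s ≠ 0) (ht : t ≠ 0)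
    (h₀ : δ 0 * a + δ 2 * p = s * δ' 0) (h₁ : δ 1 * b + δ 2 * q = s * δ' 1)
    (h₂ : δ 2 * (a * b) = s * δ' 2) (k₀ : a * ω' 0 = t * ω 0) (k₁ : b * ω' 1 = t * ω 1)
    (k₂ : p * ω' 0 + q * ω' 1 + a * b * ω' 2 = t * ω 2) :
    (model .J33 δ ω).Iso (model .J33 δ' ω') := by
  refine iso_of_matrix !![a, 0, 0; 0, b, 0; p, q, a * b] s t ?_ hs ht (fun x y => ?_)
    (fun i => ?_) ?_
  · simp [Matrix.det_fin_three, ha, hb]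
  · ext i; fin_cases i <;> simp [evenMul, Matrix.mulVec, dotProduct, Fin.sum_univ_three] <;> ring
  · fin_cases i <;> simp [h₀, h₁, h₂]
  · ext i; fin_cases i <;> simp [Matrix.mulVec, dotProduct, Fin.sum_univ_three, k₀, k₁, k₂]

/-- The automorphism of `J33` that exchanges the generators. -/
theorem iso_J33_swap : (model .J33 δ ω).Iso
    (model .J33 ![δ 1, δ 0, δ 2] ![ω 1, ω 0, ω 2]) := by
  refine iso_of_matrix !![0, 1, 0; 1, 0, 0; 0, 0, 1] 1 1 ?_ one_ne_zero one_ne_zero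
    (fun x y => ?_) (fun i => ?_) ?_
  · simp [Matrix.det_fin_three]
  · ext i; fin_cases i <;> simp [evenMul, Matrix.mulVec, dotProduct, Fin.sum_univ_three] <;> ring
  · fin_cases i <;> simp
  · ext i; fin_cases i <;> simp [Matrix.mulVec, dotProduct, Fin.sum_univ_three]

/-- Unipotent automorphisms of `J34`. -/
theorem iso_J34 (b s t : ℂ) (hs : s ≠ 0) (ht : t ≠ 0)
    (h₀ : δ 0 + δ 1 * b = s * δ' 0) (h₁ : δ 1 + δ 2 * (2 * b) = s * δ' 1)
    (h₂ : δ 2 = s * δ' 2) (k₀ : ω' 0 = t * ω 0) (k₁ : b * ω' 0 + ω' 1 = t * ω 1)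
    (k₂ : 2 * b * ω' 1 + ω' 2 = t * ω 2) :
    (model .J34 δ ω).Iso (model .J34 δ' ω') := by
  refine iso_of_matrix !![1, 0, 0; b, 1, 0; 0, 2 * b, 1] s t ?_ hs ht (fun x y => ?_)
    (fun i => ?_) ?_
  · simp [Matrix.det_fin_three]
  · ext i; fin_cases i <;> simp [evenMul, Matrix.mulVec, dotProduct, Fin.sum_univ_three] <;> ring
  · fin_cases i
    · simpa using h₀
    · simpa using h₁
    · simpa using h₂
  · ext i; fin_cases i <;> simp [Matrix.mulVec, dotProduct, Fin.sum_univ_three]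
    exacts [k₀, k₁, k₂]

/-- Admissibility gives `ω = 0` if `δ₁ ≠ 0`, and `ω ∈ ℂe₂` if `δ₁ = 0 ≠ δ₂`. If only `δ₀` survives
then `ω₀ = 0`; if `δ = 0` then `ω` is free. -/
theorem exists_table_J32 (h : Admissible .J32 δ ω) : ∃ n, (model .J32 δ ω).Iso (table n) := by
  have e1 := h.deriv ![1, 0, 0] ![1, 0, 0]
  have e2 := congrFun (h.deriv ![1, 0, 0] ![0, 1, 0]) 1
  have e3 := congrFun (h.deriv ![1, 0, 0] ![0, 0, 1]) 1
  have e4 := h.form_self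
  have e10 := congrFun e1 0
  have e11 := congrFun e1 1
  have e12 := congrFun e1 2
  simp [evenMul, form_apply] at e10 e11 e12 e2 e3 e4
  by_cases h1 : δ 1 = 0
  · simp only [h1, zero_mul, add_zero] at e11 e4
    have e01 : δ 0 * ω 0 = 0 := by linear_combination e11 / 2
    by_cases h2 : δ 2 = 0
    · by_cases h0 : δ 0 = 0
      · by_cases w0 : ω 0 = 0
        · by_cases w2 : ω 2 = 0
          · by_cases w1 : ω 1 = 0
            · refine ⟨4, ?_⟩
              rw [table_eq]
              apply iso_J32 1 0 0 0 1 1 1 <;> simp [tableForm, tableVec, *]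
            · refine ⟨6, ?_⟩
              rw [table_eq]
              apply iso_J32 1 0 0 0 1 1 (ω 1)⁻¹ <;> simp [tableForm, tableVec, *]
          · refine ⟨7, ?_⟩
            rw [table_eq]
            -- This automorphism sends `e₃` to `ω`.
            apply iso_J32 1 0 0 (ω 1) (ω 2) 1 1 <;> simp [tableForm, tableVec, *]
        · refine ⟨5, ?_⟩
          rw [table_eq]
          apply iso_J32 (ω 0) (ω 1) (ω 2) 0 1 1 1 <;> simp [tableForm, tableVec, *]
      · have w0 : ω 0 = 0 := by simpa [h0] using e01
        by_cases w2 : ω 2 = 0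
        · by_cases w1 : ω 1 = 0
          · refine ⟨11, ?_⟩
            rw [table_eq]
            apply iso_J32 1 0 0 0 1 (δ 0) 1 <;> simp [tableForm, tableVec, *]
          · refine ⟨12, ?_⟩
            rw [table_eq]
            apply iso_J32 1 0 0 0 1 (δ 0) (ω 1)⁻¹ <;> simp [tableForm, tableVec, *]
        · refine ⟨13, ?_⟩
          rw [table_eq]
          apply iso_J32 1 0 0 (ω 1) (ω 2) (δ 0) 1 <;> simp [tableForm, tableVec, *]
    · have w0 : ω 0 = 0 := by simpa [h2] using e3
      have w2 : ω 2 = 0 := by simpa [h2, w0] using e4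
      by_cases w1 : ω 1 = 0
      · refine ⟨9, ?_⟩
        rw [table_eq]
        apply iso_J32 1 0 (-δ 0 / δ 2) 0 1 (δ 2) 1 <;>
          simp [tableForm, tableVec, mul_div_cancel₀, *]
      · refine ⟨10, ?_⟩
        rw [table_eq]
        apply iso_J32 1 0 (-δ 0 / δ 2) 0 1 (δ 2) (ω 1)⁻¹ <;>
          simp [tableForm, tableVec, mul_div_cancel₀, *]
  · have w0 : ω 0 = 0 := by simpa [h1] using e2
    have w1 : ω 1 = 0 := by simpa [h1, w0, eq_comm] using e11
    have w2 : ω 2 = 0 := by simpa [h1, eq_comm] using e12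
    refine ⟨8, ?_⟩
    rw [table_eq]
    -- Subtracting multiples of `e₂` moves `e₁` and `e₃` into the kernel of `δ`.
    apply iso_J32 1 (-δ 0 / δ 1) 0 (-δ 2 / δ 1) 1 (δ 1) 1 <;>
      simp [tableForm, tableVec, mul_div_cancel₀, *]

theorem exists_table_J33_zero (w0 : ω 0 ≠ 0) (h0 : δ 0 = 0) (h1 : δ 1 = 0) (h2 : δ 2 = 0) :
    ∃ n, (model .J33 δ ω).Iso (table n) := by
  by_cases w1 : ω 1 = 0
  · refine ⟨15, ?_⟩
    rw [table_eq]
    apply iso_J33 (ω 0) 1 (ω 2) 0 1 1 <;> simp [tableForm, tableVec, *]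
  · refine ⟨17, ?_⟩
    rw [table_eq]
    apply iso_J33 (ω 0) (ω 1) (ω 2) 0 1 1 <;> simp [tableForm, tableVec, *]

theorem exists_table_J33_central (w0 : ω 0 = 0) (w1 : ω 1 = 0) (h0 : δ 0 ≠ 0) (h2 : δ 2 = 0) :
    ∃ n, (model .J33 δ ω).Iso (table n) := by
  by_cases h1 : δ 1 = 0
  · by_cases w2 : ω 2 = 0
    · refine ⟨19, ?_⟩
      rw [table_eq]
      apply iso_J33 1 1 0 0 (δ 0) 1 <;> simp [tableForm, tableVec, *]
    · refine ⟨20, ?_⟩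
      rw [table_eq]
      apply iso_J33 1 1 0 0 (δ 0) (ω 2)⁻¹ <;> simp [tableForm, tableVec, *]
  · by_cases w2 : ω 2 = 0
    · refine ⟨21, ?_⟩
      rw [table_eq]
      apply iso_J33 (δ 0)⁻¹ (δ 1)⁻¹ 0 0 1 1 <;> simp [tableForm, tableVec, *]
    · refine ⟨22, ?_⟩
      rw [table_eq]
      apply iso_J33 (δ 0)⁻¹ (δ 1)⁻¹ 0 0 1 ((δ 0)⁻¹ * (δ 1)⁻¹ * (ω 2)⁻¹) <;>
        simp [tableForm, tableVec, *]

/-- If `δ₂ ≠ 0` then `ω = 0`; if `δ₂ = 0` but `δ ≠ 0` then `ω ∈ ℂe₃`; if `δ = 0` then `ω` is free.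
Exchanging `e₁` and `e₂` removes the symmetric cases. -/
theorem exists_table_J33 (h : Admissible .J33 δ ω) : ∃ n, (model .J33 δ ω).Iso (table n) := by
  have e1 := congrFun (h.deriv ![1, 0, 0] ![1, 0, 0]) 2
  have e2 := congrFun (h.deriv ![0, 1, 0] ![0, 1, 0]) 2
  have e3 := h.deriv ![1, 0, 0] ![0, 1, 0]
  have e30 := congrFun e3 0
  have e31 := congrFun e3 1
  have e32 := congrFun e3 2
  simp [evenMul, form_apply] at e1 e2 e30 e31 e32
  have e1' : δ 0 * ω 1 = 0 := by simpa using e1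
  have e2' : δ 1 * ω 0 = 0 := by simpa using e2
  by_cases h2 : δ 2 = 0
  · by_cases h0 : δ 0 = 0
    · by_cases h1 : δ 1 = 0
      · by_cases w0 : ω 0 = 0
        · by_cases w1 : ω 1 = 0
          · by_cases w2 : ω 2 = 0
            · refine ⟨14, ?_⟩
              rw [table_eq]
              apply iso_J33 1 1 0 0 1 1 <;> simp [tableForm, tableVec, *]
            · refine ⟨16, ?_⟩
              rw [table_eq]
              apply iso_J33 1 1 0 0 1 (ω 2)⁻¹ <;> simp [tableForm, tableVec, *]
          · obtain ⟨n, hn⟩ := exists_table_J33_zero (δ := ![δ 1, δ 0, δ 2])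
              (ω := ![ω 1, ω 0, ω 2]) w1 h1 h0 h2
            exact ⟨n, iso_J33_swap.trans hn⟩
        · exact exists_table_J33_zero w0 h0 h1 h2
      · have w0 : ω 0 = 0 := by simpa [h1] using e2'
        have w1 : ω 1 = 0 := by simpa [h0, h1, h2] using e32
        obtain ⟨n, hn⟩ := exists_table_J33_central (δ := ![δ 1, δ 0, δ 2])
          (ω := ![ω 1, ω 0, ω 2]) w1 w0 h1 h2
        exact ⟨n, iso_J33_swap.trans hn⟩
    · have w1 : ω 1 = 0 := by simpa [h0] using e1'
      have w0 : ω 0 = 0 := by simpa [h0, h2, w1] using e32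
      exact exists_table_J33_central w0 w1 h0 h2
  · have w0 : ω 0 = 0 := by simpa [h2] using e30
    have w1 : ω 1 = 0 := by simpa [h2] using e31
    have w2 : ω 2 = 0 := by simpa [h2, w0, w1, eq_comm] using e32
    refine ⟨18, ?_⟩
    rw [table_eq]
    apply iso_J33 1 1 (-δ 0 / δ 2) (-δ 1 / δ 2) (δ 2) 1 <;>
      simp [tableForm, tableVec, mul_div_cancel₀, *]

/-- Here `ω₀ = δ₂ = 0` always, with `δ₁ω₁ = 0` and `2δ₀ω₁ = δ₁ω₂`. Unipotent automorphisms suffice,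
since the scalars `s, t` do the normalising. -/
theorem exists_table_J34 (h : Admissible .J34 δ ω) : ∃ n, (model .J34 δ ω).Iso (table n) := by
  have w0 := congrFun (h.mul_sq ![1, 0, 0] ![1, 0, 0]) 2
  have h2 := h.form_cube ![1, 0, 0] ![1, 0, 0] ![1, 0, 0]
  have e1 := congrFun (h.deriv ![1, 0, 0] ![1, 0, 0]) 2
  have e4 := h.form_self
  simp [evenMul, form_apply] at w0 h2 e1 e4
  simp only [w0, h2, mul_zero, zero_mul, add_zero, zero_add] at e4
  have e1' : 2 * δ 0 * ω 1 = δ 1 * ω 2 := by linear_combination e1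
  by_cases h1 : δ 1 = 0
  · by_cases h0 : δ 0 = 0
    · by_cases w1 : ω 1 = 0
      · by_cases w2 : ω 2 = 0
        · refine ⟨23, ?_⟩
          rw [table_eq]
          apply iso_J34 0 1 1 <;> simp [tableForm, tableVec, *]
        · refine ⟨25, ?_⟩
          rw [table_eq]
          apply iso_J34 0 1 (ω 2)⁻¹ <;> simp [tableForm, tableVec, *]
      · refine ⟨24, ?_⟩
        rw [table_eq]
        -- Chosen so that the image `e₂ + 2b e₃` of `e₂` is proportional to `ω`.
        apply iso_J34 ((ω 1)⁻¹ * ω 2 / 2) 1 (ω 1)⁻¹ <;>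
          simp [tableForm, tableVec, mul_div_cancel₀, *]
    · have w1 : ω 1 = 0 := by simpa [h0, h1] using e1'
      by_cases w2 : ω 2 = 0
      · refine ⟨27, ?_⟩
        rw [table_eq]
        apply iso_J34 0 (δ 0) 1 <;> simp [tableForm, tableVec, *]
      · refine ⟨28, ?_⟩
        rw [table_eq]
        apply iso_J34 0 (δ 0) (ω 2)⁻¹ <;> simp [tableForm, tableVec, *]
  · have w1 : ω 1 = 0 := by simpa [h1] using e4
    have w2 : ω 2 = 0 := by simpa [h1, w1, eq_comm] using e1'
    refine ⟨26, ?_⟩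
    rw [table_eq]
    apply iso_J34 (-δ 0 / δ 1) (δ 1) 1 <;> simp [tableForm, tableVec, mul_div_cancel₀, *]

theorem Superalgebra.exists_iso_table {J : Type*} [AddCommGroup J] [Module ℂ J]
    {A : Superalgebra J} (hJ : A.IsJordan) (hA : A.IsNilpotent) (hT : A.HasType 3 2) :
    ∃ n, A.Iso (table n) := by
  obtain ⟨r, δ, ω, h⟩ := exists_iso_model hJ hA hT
  have hadm : Admissible r δ ω := by
    refine admissible_of_model (h.isJordan hJ) fun x y c hx => ?_
    obtain ⟨Φ, hm, -⟩ := h.symm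
    -- Nilpotency enters only through this consequence, so it is used in `A` and pulled back along
    -- `Φ`.
    have := hA.eq_zero_of_eq_smul_mul_mul (x := Φ x) (y := Φ y) (c := c) (by
      rw [← hm, ← hm, ← map_smul, ← hx])
    exact Φ.map_eq_zero_iff.1 this
  have : ∃ n, (model r δ ω).Iso (table n) := by
    cases r
    · exact exists_table_J31 hadm.form_self
    · exact exists_table_J32 hadm
    · exact exists_table_J33 hadm
    · exact exists_table_J34 hadm
  obtain ⟨n, hn⟩ := this
  exact ⟨n, h.trans hn⟩

end JordanSuper

/-! ### The classification theorem -/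

theorem mainTheorem2 :
    -- each of the 29 superalgebras is a nilpotent Jordan superalgebra of type (3,2)
    (∀ n : Fin 29, (JordanSuper.table n).IsJordan ∧ (JordanSuper.table n).IsNilpotent ∧
      (JordanSuper.table n).HasType 3 2) ∧
    -- they are pairwise non-isomorphic
    (∀ m n : Fin 29, m ≠ n → ¬ (JordanSuper.table m).Iso (JordanSuper.table n)) ∧
    -- they are sorted by the isomorphism class of the even part
    (∀ (n : Fin 29) (r : JordanSuper.EvenType),
      (JordanSuper.table n).EvenPartIso (JordanSuper.evenMul r) ↔ r = JordanSuper.evenType n) ∧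
    -- every nilpotent Jordan superalgebra of type (3,2) is isomorphic to exactly one of them
    (∀ (J : Type*) [AddCommGroup J] [Module ℂ J] (A : JordanSuper.Superalgebra J),
      A.IsJordan → A.IsNilpotent → A.HasType 3 2 →
        ∃! n : Fin 29, A.Iso (JordanSuper.table n)) := by
  refine ⟨fun n => ⟨?_, JordanSuper.table_isNilpotent n, ?_⟩,
    fun m n hmn h => hmn (JordanSuper.eq_of_table_iso m n h), JordanSuper.table_evenPartIso_iff,
    fun J _ _ A hJ hA hT => ?_⟩
  · rw [JordanSuper.table_eq]
    exact (JordanSuper.table_admissible n).isJordan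
  · rw [JordanSuper.table_eq]
    exact JordanSuper.model_hasType _ _ _
  · obtain ⟨n, hn⟩ := JordanSuper.Superalgebra.exists_iso_table hJ hA hT
    exact ⟨n, hn, fun m hm => JordanSuper.eq_of_table_iso m n (hm.symm.trans hn)⟩
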